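/- **Setting.** Let $\mathcal A$ be a set of $N$ agents that communicate over a connected undirected graph $\mathcal G$ of diameter $d(\mathcal G)$. Agent $i$ has a finite nonempty policy set $\mathcal P_i$; these sets are pairwise disjoint with union $\mathcal P$. Let $f:2^{\mathcal P}\to\mathbb R$ be normalized ($f(\emptyset)=0$), monotone increasing and submodular, and let $\mathcal S^\star$ maximize $f$ over the admissible sets $\mathcal I=\{\mathcal R\subseteq\mathcal P: |\mathcal R\cap\mathcal P_i|\le 1 \text{ for all } i\}$. Let $T\ge 1$ and $K_i\in\mathbb N$ ($i\in\mathcal A$). **Algorithm.** An information set is a finite set $\mathcal F$ of pairs $(p,\alpha)$ (policy, membership probability) with at most one pair per policy; its membership vector $\mathbf x$ has $x_p=\alpha$ if $(p,\alpha)\in\mathcal F$ and $x_p=0$ if $p$ has no pair. Initially $\mathcal F_i=\emptyset$ for all $i$. In each of $T$ time steps, every agent $i$ 1. draws $K_i$ independent random sets $\mathcal R$, each containing every $q\in\mathcal P$ independently with probability $x_{iq}$, where $\mathbf x_i$ is the membership vector of $\mathcal F_i$ (draws of different agents and time steps use independent randomness); 2. computes for each $p\in\mathcal P_i$ the average $w^i_p$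 of $f(\mathcal R\cup\{p\})-f(\mathcal R\setminus\{p\})$ over the sampled sets; 3. picks $p^\star\in\arg\max_{p\in\mathcal P_i}w_p^i$ (ties broken by any fixed rule, possibly depending on the agent and the time step) and forms $\mathcal F_i^-$ from $\mathcal F_i$ by adding $1/T$ to the value of $p^\star$ (inserting $(p^\star,1/T)$ if $p^\star$ has no value); 4. replaces $\mathcal F_i$ by the set of those pairs of $\bigcup_j\mathcal F_j^-$, with $j$ ranging over $i$ and its neighbors, that have the largest value for their policy. After $T$ steps, the agents independently sample one policy each, agent $i$ choosing $p\in\mathcal P_i$ with probability $x_{ip}(T)$; $\bar{\mathcal P}$ is the set of the sampled policies. *Batches.* More generally, let a map $\beta$ from $\mathcal P$ to a finite set of labels be given. For each label, agent $i$ draws a separate independent batch of $K_i$ sets in step 1, and in step 2 it computes $w_p^i$ from the batch with label $\beta(p)$. Constant $\beta$ is the algorithm above, in which all policies of an agent use the same $K_i$ sets; injective $\beta$ means that the estimates of different policies use independently drawn sets. **Theorem.** Suppose that $2\,m\,e^{-K_i/(8T^2)}\le 1$ for every agent $i$ and every number $m=|\{p\in\mathcal P_i:\beta(p)=l\}|$,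 $l$ a label (for the algorithm with one common batch per agent: $2\,|\mathcal P_i|\,e^{-K_i/(8T^2)}\le 1$; for separate batches: $2e^{-K_i/(8T^2)}\le 1$). Then: * all membership probabilities $x_{ip}(t)$, $0\le t\le T$, lie in $[0,1]$, $\sum_{p\in\mathcal P_i}x_{ip}(T)=1$ for every $i$, and $\bar{\mathcal P}\in\mathcal I$ always; * with probability at least $\Big(\prod_{i\in\mathcal A}\big(1-2e^{-K_i/(8T^2)}\big)^{|\mathcal P_i|}\Big)^T$ over the sets sampled in the $T$ time steps, $$\Big(1-\frac1e\Big)\Big(1-\Big(2N^2d(\mathcal G)+\tfrac12N^2+N\Big)\frac1T\Big)f(\mathcal S^\star)\ \le\ \mathbb E[f(\bar{\mathcal P})],$$ where $\mathbb E$ is the expectation over the final sampling of the policies, given the final information sets. -/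

import Mathlib

open scoped BigOperators

noncomputable section

namespace DistGreedy

/-! ### Set functions and the optimization problem -/

/-- Diminishing returns: `f (S₁ ∪ {p}) - f S₁ ≥ f (S₂ ∪ {p}) - f S₂` whenever `S₁ ⊆ S₂`
and `p ∉ S₂`. -/
def IsSubmodular {P : Type*} [DecidableEq P] (f : Finset P → ℝ) : Prop :=
  ∀ S₁ S₂ : Finset P, S₁ ⊆ S₂ → ∀ p, p ∉ S₂ →
    f (insert p S₂) - f S₂ ≤ f (insert p S₁) - f S₁

/-- Independent sets of the partition matroid: at most one policy per agent. -/
def Admissible {A P : Type*} [DecidableEq P] (Pol : A → Finset P) (R : Finset P) : Prop :=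
  ∀ i, (R ∩ Pol i).card ≤ 1

/-- `S` maximizes `f` over the partition matroid. -/
def IsOptimizer {A P : Type*} [DecidableEq P] (Pol : A → Finset P) (f : Finset P → ℝ)
    (S : Finset P) : Prop :=
  Admissible Pol S ∧ ∀ R, Admissible Pol R → f R ≤ f S

/-! ### Finite random objects -/

/-- The law of a finite family of independent random variables with laws `μ i`. -/
def indep {ι : Type*} [Fintype ι] [DecidableEq ι] {X : ι → Type*} [∀ i, Fintype (X i)]
    (μ : ∀ i, PMF (X i)) : PMF (∀ i, X i) :=
  PMF.ofFintype (fun x => ∏ i, μ i (x i)) (by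
    rw [← Fintype.prod_sum (fun i a => μ i a)]
    refine Finset.prod_eq_one fun i _ => ?_
    rw [← tsum_fintype (L := SummationFilter.unconditional _)]
    exact (μ i).tsum_coe)

/-- Truncation of a real number to `[0, 1]`. -/
def clip (a : ℝ) : ℝ := max 0 (min 1 a)

theorem clip_nonneg (a : ℝ) : 0 ≤ clip a := le_max_left _ _

theorem clip_le_one (a : ℝ) : clip a ≤ 1 := max_le zero_le_one (min_le_left _ _)

/-- The law of the random set `R_x` that contains each `p` independently with probability `x p`.
(The truncation only serves to have a law for every `x`; it does nothing if `0 ≤ x p ≤ 1`.) -/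
def randomSet {P : Type*} [Fintype P] [DecidableEq P] (x : P → ℝ) : PMF (Finset P) :=
  PMF.ofFintype
    (fun R => ENNReal.ofReal ((∏ p ∈ R, clip (x p)) * ∏ p ∈ Rᶜ, (1 - clip (x p)))) (by
    rw [← ENNReal.ofReal_sum_of_nonneg, ← Fintype.prod_add]
    · simp
    · intro R _
      exact mul_nonneg (Finset.prod_nonneg fun p _ => clip_nonneg _)
        (Finset.prod_nonneg fun p _ => sub_nonneg.2 (clip_le_one _)))

/-! ### Information sets -/

/-- An information set: finitely many pairs (policy, membership probability). -/
abbrev Info (P : Type*) := Finset (P × ℝ)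

/-- `F ⊕ {(p, a)}`: add `a` to the value attached to `p`, or insert `(p, a)` if `p` has no
value yet. -/
def Info.add {P : Type*} [DecidableEq P] (F : Info P) (p : P) (a : ℝ) : Info P :=
  open Classical in
  F.filter (fun u => u.1 ≠ p)
    ∪ (F.filter (fun u => u.1 = p)).image (fun u => (u.1, u.2 + a))
    ∪ (if ∃ c, (p, c) ∈ F then ∅ else {(p, a)})

/-- The operation `MAX` over a family of information sets: from the union of the family, keep the
pairs whose value is the largest one attached to their policy. -/
def Info.max {P ι : Type*} (s : Finset ι) (F : ι → Info P) : Info P :=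
  open Classical in
  (s.biUnion F).filter (fun u => ∀ c, (u.1, c) ∈ s.biUnion F → c ≤ u.2)

/-- The membership probability vector read off an information set: `x p = a` if `(p, a) ∈ F`, and
`0` if `p` has no value. (The information sets of the algorithm hold at most one pair for
each `p`, so the sum has at most one term.) -/
def Info.prob {P : Type*} [DecidableEq P] (F : Info P) (p : P) : ℝ :=
  ∑ u ∈ F.filter (fun u => u.1 = p), u.2

/-! ### The distributed algorithm -/

section Algorithm

variable {A P L : Type*} [Fintype A] [DecidableEq A] [Fintype P] [DecidableEq P]
  [Fintype L] [DecidableEq L]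

/-- The sample sets drawn by all agents in one time step: `ω i l k` is the `k`-th of the `K i` sets
in the batch with label `l` of agent `i`. With a one-element label type every agent draws exactly
one batch of `K i` sets. -/
abbrev Samples (P L : Type*) {A : Type*} (K : A → ℕ) := ∀ i : A, L → Fin (K i) → Finset P

/-- All sample sets of one time step are drawn independently, those of agent `i` according to its
current membership probabilities. -/
def drawSamples (K : A → ℕ) (F : A → Info P) : PMF (Samples P L K) :=
  indep fun i => indep fun _ : L => indep fun _ : Fin (K i) => randomSet (F i).prob

/-- The estimate of `E[f(R ∪ {p}) - f(R \ {p})]`: the average over a batch of `k` sets. -/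
def estimate (f : Finset P → ℝ) {k : ℕ} (R : Fin k → Finset P) (p : P) : ℝ :=
  (∑ j, (f (insert p (R j)) - f ((R j).erase p))) / k

/-- A rule that selects, at every time step and for every agent, a policy of that agent from
the estimates of all its policies. -/
abbrev Selection (Pol : A → Finset P) :=
  ℕ → ∀ i : A, ({p // p ∈ Pol i} → ℝ) → {p // p ∈ Pol i}

/-- The selected policy always maximizes the estimate; ties are broken in any way. -/
def Selection.IsArgmax {Pol : A → Finset P} (sel : Selection Pol) : Prop :=
  ∀ (t : ℕ) (i : A) (w : {p // p ∈ Pol i} → ℝ) (p : {p // p ∈ Pol i}), w p ≤ w (sel t i w)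

variable (G : SimpleGraph A) (Pol : A → Finset P) (f : Finset P → ℝ) (T : ℕ) (K : A → ℕ)
  (β : P → L) (sel : Selection Pol)

/-- The propagated information sets: agent `i` estimates the gain of each of its policies `p` on its
batch with label `β p` and adds `1 / T` to the probability of the selected policy. -/
def propagate (t : ℕ) (F : A → Info P) (ω : Samples P L K) (i : A) : Info P :=
  (F i).add (sel t i fun p => estimate f (ω i (β p)) p) (1 / T)

/-- An agent together with its neighbors in the communication graph. -/
def closedNbhd (i : A) : Finset A :=
  open Classical in Finset.univ.filter fun j => j = i ∨ G.Adj i j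

/-- One time step: propagation, then `MAX` over the agent and its neighbors. -/
def step (t : ℕ) (F : A → Info P) (ω : Samples P L K) (i : A) : Info P :=
  Info.max (closedNbhd G i) (propagate Pol f T K β sel t F ω)

/-- The law of the information sets of all agents after `t` time steps. -/
def run : ℕ → PMF (A → Info P)
  | 0 => PMF.pure fun _ => ∅
  | t + 1 => (run t).bind fun F =>
      (drawSamples (L := L) K F).map (step G Pol f T K β sel t F)

/-- Agent `i` samples one policy of `Pol i` with its own membership probabilities. (If these do not
sum to one, nothing is sampled.) -/
def samplePolicy (F : A → Info P) (i : A) : PMF (Finset P) :=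
  open Classical in
  if h : ∑ p : {p // p ∈ Pol i}, ENNReal.ofReal ((F i).prob p) = 1 then
    (PMF.ofFintype (fun p : {p // p ∈ Pol i} => ENNReal.ofReal ((F i).prob p)) h).map
      fun p => {(p : P)}
  else PMF.pure ∅

/-- The law of the output policy set, given the final information sets: the agents sample
independently and their choices are collected. -/
def output (F : A → Info P) : PMF (Finset P) :=
  (indep (samplePolicy Pol F)).map fun s => Finset.univ.biUnion s

/-- The expected utility of the output policy set, given the final information sets. -/
def expectedUtility (F : A → Info P) : ℝ :=
  ∑ S : Finset P, (output Pol F S).toReal * f S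

end Algorithm

end DistGreedy

end

/-!
Let `φ` be the multilinear extension of `f`, let `y p` be the probability that the owner of the
policy `p` assigns to it, and let `N` and `d` be the number of agents and the diameter of the graph.
In each time step every agent raises `y` at one of its policies by `1 / T`. By submodularity and
monotonicity, `f S - φ y` is at most the sum over `p ∈ S` of the partial derivatives of `φ` at `y`,
and these are in turn dominated by the derivatives in the selected directions, up to two errors. An
agent knows `y` only up to the last `d` increments of the other agents, which by submodularity can
only make its own policies look more attractive, by at most `N * d / T` times the largest marginal
gain `M`. Its estimates of the derivatives deviate from them by at most `M / (2 * T)` with the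
stated probability, by Hoeffding's inequality. Together with the second order term of `φ`, a time
step therefore multiplies the gap between `φ y` and `f S` minus the total loss by `1 - 1 / T`, and
`(1 - 1 / T) ^ T ≤ 1 / e`.

The final sampling loses nothing: replacing the independent inclusion of the policies of one agent
by the choice of exactly one of them does not decrease the expected value of a submodular function,
because marginal gains shrink as soon as a second policy of that agent is present.
-/

namespace DistGreedy

/-! ### Marginal gains of a set function -/

section Marginal

variable {P : Type*} [DecidableEq P] {f : Finset P → ℝ}

/-- The marginal gain `f (R ∪ {p}) - f (R \ {p})` of `p` at `R`. It does not depend on whether `p`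
belongs to `R`, so that `marginal f p` is the discrete partial derivative of `f` in direction
`p`. -/
def marginal (f : Finset P → ℝ) (p : P) (R : Finset P) : ℝ :=
  f (insert p R) - f (R.erase p)

theorem insert_erase_eq_insert (p : P) (R : Finset P) : insert p (R.erase p) = insert p R := by
  ext q
  by_cases hq : q = p <;> simp [hq]

theorem IsSubmodular.marginal_antitone (hsub : IsSubmodular f) (p : P) :
    Antitone (marginal f p) := by
  intro R S hRS
  have h := hsub (R.erase p) (S.erase p) (Finset.erase_subset_erase p hRS) p
    (Finset.notMem_erase p S)
  simpa only [marginal, insert_erase_eq_insert] using h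

theorem marginal_nonneg (hmono : Monotone f) (p : P) (R : Finset P) : 0 ≤ marginal f p R :=
  sub_nonneg.2 (hmono ((Finset.erase_subset p R).trans (Finset.subset_insert p R)))

theorem IsSubmodular.marginal_le (hsub : IsSubmodular f) (p : P) (R : Finset P) :
    marginal f p R ≤ f {p} - f ∅ := by
  simpa [marginal] using hsub.marginal_antitone p R.empty_subset

theorem IsSubmodular.union_le_add_sum_marginal (hsub : IsSubmodular f) (hmono : Monotone f)
    (R S : Finset P) : f (R ∪ S) ≤ f R + ∑ p ∈ S, marginal f p R := by
  induction S using Finset.induction_on with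
  | empty => simp
  | insert p S hp ih =>
    rw [Finset.sum_insert hp, Finset.union_insert]
    by_cases hpR : p ∈ R ∪ S
    · rw [Finset.insert_eq_of_mem hpR]
      linarith [marginal_nonneg hmono p R]
    · have gain_le : f (insert p (R ∪ S)) - f (R ∪ S) ≤ f (insert p R) - f R :=
        hsub R (R ∪ S) Finset.subset_union_left p hpR
      have erase_le : f (R.erase p) ≤ f R := hmono (Finset.erase_subset p R)
      rw [marginal]
      linarith

theorem IsSubmodular.union_right (hsub : IsSubmodular f) (D : Finset P) :
    IsSubmodular fun R => f (R ∪ D) := by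
  intro S₁ S₂ hS p hp
  dsimp only
  rw [Finset.insert_union, Finset.insert_union]
  by_cases hD : p ∈ D
  · simp [Finset.insert_eq_of_mem (Finset.mem_union_right _ hD)]
  · exact hsub _ _ (Finset.union_subset_union_left hS) p (by simp [hp, hD])

end Marginal

/-! ### The multilinear extension -/

section Multilinear

variable {P : Type*} [DecidableEq P] [Fintype P]

/-- The probability that the random set containing every `p` independently with probability `x p`
equals `R`. -/
def inclusionWeight (x : P → ℝ) (R : Finset P) : ℝ :=
  (∏ p ∈ R, x p) * ∏ p ∈ Rᶜ, (1 - x p)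

/-- The multilinear extension `∑ R, Pr[R_x = R] * g R` of a set function `g` at `x`, as a linear
functional of `g`. -/
def multilinear (x : P → ℝ) : (Finset P → ℝ) →ₗ[ℝ] ℝ :=
  ∑ R, inclusionWeight x R • LinearMap.proj R

theorem multilinear_apply (x : P → ℝ) (g : Finset P → ℝ) :
    multilinear x g = ∑ R, inclusionWeight x R * g R := by
  simp [multilinear]

theorem inclusionWeight_nonneg {x : P → ℝ} (hx : x ∈ Set.Icc 0 1) (R : Finset P) :
    0 ≤ inclusionWeight x R :=
  mul_nonneg (Finset.prod_nonneg fun p _ => hx.1 p)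
    (Finset.prod_nonneg fun p _ => sub_nonneg.2 (hx.2 p))

theorem multilinear_mono {x : P → ℝ} (hx : x ∈ Set.Icc 0 1) : Monotone (multilinear x) := by
  intro g h hgh
  simp only [multilinear_apply]
  exact Finset.sum_le_sum fun R _ =>
    mul_le_mul_of_nonneg_left (hgh R) (inclusionWeight_nonneg hx R)

theorem multilinear_const (x : P → ℝ) (c : ℝ) : multilinear x (fun _ => c) = c := by
  simp only [multilinear_apply, inclusionWeight]
  rw [← Finset.sum_mul, ← Fintype.prod_add]
  simp

theorem multilinear_le_of_forall_le {x : P → ℝ} (hx : x ∈ Set.Icc 0 1) {g : Finset P → ℝ} {c : ℝ}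
    (hg : ∀ R, g R ≤ c) : multilinear x g ≤ c :=
  (multilinear_mono hx hg).trans_eq (multilinear_const x c)

theorem le_multilinear_of_forall_le {x : P → ℝ} (hx : x ∈ Set.Icc 0 1) {g : Finset P → ℝ} {c : ℝ}
    (hg : ∀ R, c ≤ g R) : c ≤ multilinear x g :=
  (multilinear_const x c).symm.trans_le (multilinear_mono hx hg)

theorem multilinear_zero (g : Finset P → ℝ) : multilinear (0 : P → ℝ) g = g ∅ := by
  rw [multilinear_apply, Finset.sum_eq_single ∅]
  · simp [inclusionWeight]
  · intro R _ hR
    obtain ⟨p, hp⟩ := Finset.nonempty_iff_ne_empty.2 hR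
    rw [inclusionWeight, Finset.prod_eq_zero hp rfl, zero_mul, zero_mul]
  · simp

theorem multilinear_eq_sum_powerset_erase (x : P → ℝ) (g : Finset P → ℝ) (p : P) :
    multilinear x g = ∑ R ∈ (Finset.univ.erase p).powerset,
      ((∏ q ∈ R, x q) * ∏ q ∈ Finset.univ.erase p \ R, (1 - x q)) *
        (g (R.erase p) + x p * marginal g p R) := by
  have huniv : (Finset.univ : Finset (Finset P)) = (insert p (Finset.univ.erase p)).powerset := by
    rw [Finset.insert_erase (Finset.mem_univ p), Finset.powerset_univ]
  rw [multilinear_apply, huniv, Finset.sum_powerset_insert (Finset.notMem_erase p _),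
    ← Finset.sum_add_distrib]
  refine Finset.sum_congr rfl fun R hR => ?_
  have hp : p ∉ R := fun h => Finset.notMem_erase p _ (Finset.mem_powerset.1 hR h)
  have compl_eq : Rᶜ = insert p (Finset.univ.erase p \ R) := by
    ext q; by_cases hq : q = p <;> simp [hq, hp]
  have compl_insert_eq : (insert p R)ᶜ = Finset.univ.erase p \ R := by
    ext q; by_cases hq : q = p <;> simp [hq]
  rw [inclusionWeight, inclusionWeight, compl_insert_eq, compl_eq, Finset.prod_insert hp,
    Finset.prod_insert (by simp), marginal, Finset.erase_eq_of_notMem hp]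
  ring

theorem multilinear_update (x : P → ℝ) (g : Finset P → ℝ) (p : P) (a : ℝ) :
    multilinear (Function.update x p a) g =
      multilinear x g + (a - x p) * multilinear x (marginal g p) := by
  simp only [multilinear_eq_sum_powerset_erase _ _ p, Finset.mul_sum, ← Finset.sum_add_distrib]
  refine Finset.sum_congr rfl fun R hR => ?_
  have hp : p ∉ R := fun h => Finset.notMem_erase p _ (Finset.mem_powerset.1 hR h)
  have prod_eq : ∏ q ∈ R, Function.update x p a q = ∏ q ∈ R, x q :=
    Finset.prod_update_of_notMem hp _ _
  have prod_compl_eq : ∏ q ∈ Finset.univ.erase p \ R, (1 - Function.update x p a q) =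
      ∏ q ∈ Finset.univ.erase p \ R, (1 - x q) :=
    Finset.prod_congr rfl fun q hq => by
      rw [Function.update_of_ne (Finset.ne_of_mem_erase (Finset.mem_sdiff.1 hq).1)]
  rw [prod_eq, prod_compl_eq, Function.update_self]
  simp only [marginal, Finset.insert_idem, Finset.erase_insert_eq_erase, Finset.erase_idem,
    insert_erase_eq_insert]
  ring

theorem multilinear_comp_erase {x : P → ℝ} {p : P} (hp : x p = 0) (g : Finset P → ℝ) :
    multilinear x (fun R => g (R.erase p)) = multilinear x g := by
  simp [multilinear_eq_sum_powerset_erase x _ p, hp]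

theorem multilinear_piecewise_insert (x y : P → ℝ) (g : Finset P → ℝ) {s : Finset P} {p : P}
    (hp : p ∉ s) : multilinear ((insert p s).piecewise y x) g =
      multilinear (s.piecewise y x) g +
        (y p - x p) * multilinear (s.piecewise y x) (marginal g p) := by
  rw [Finset.piecewise_insert, multilinear_update, Finset.piecewise_eq_of_notMem _ _ _ hp]

theorem multilinear_le_add_sum_of_marginal_le {g : Finset P → ℝ} {x y c : P → ℝ} (hxy : x ≤ y)
    (hc : ∀ p, ∀ z ∈ Set.Icc x y, multilinear z (marginal g p) ≤ c p) :
    multilinear y g ≤ multilinear x g + ∑ p, (y p - x p) * c p := by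
  suffices h : ∀ s : Finset P,
      multilinear (s.piecewise y x) g ≤ multilinear x g + ∑ p ∈ s, (y p - x p) * c p by
    simpa using h Finset.univ
  intro s
  induction s using Finset.induction_on with
  | empty => simp
  | insert p s hp ih =>
    rw [multilinear_piecewise_insert x y g hp, Finset.sum_insert hp]
    have := mul_le_mul_of_nonneg_left (hc p _ (s.piecewise_mem_Icc' hxy)) (sub_nonneg.2 (hxy p))
    linarith

theorem multilinear_antitone {h : Finset P → ℝ} (hanti : Antitone h) {x y : P → ℝ} (hx : 0 ≤ x)
    (hxy : x ≤ y) (hy : y ≤ 1) : multilinear y h ≤ multilinear x h := by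
  have marginal_le : ∀ p, ∀ z ∈ Set.Icc x y, multilinear z (marginal h p) ≤ 0 := fun p z hz =>
    multilinear_le_of_forall_le ⟨hx.trans hz.1, hz.2.trans hy⟩ fun R =>
      sub_nonpos.2 (hanti ((Finset.erase_subset p R).trans (Finset.subset_insert p R)))
  simpa using multilinear_le_add_sum_of_marginal_le hxy marginal_le

theorem multilinear_le_add_mul_sum_sub {h : Finset P → ℝ} {M : ℝ} (h0 : ∀ R, 0 ≤ h R)
    (hM : ∀ R, h R ≤ M) {x y : P → ℝ} (hx : 0 ≤ x) (hxy : x ≤ y) (hy : y ≤ 1) :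
    multilinear x h ≤ multilinear y h + M * ∑ p, (y p - x p) := by
  have marginal_neg_le : ∀ p, ∀ z ∈ Set.Icc x y, multilinear z (marginal (-h) p) ≤ M :=
    fun p z hz => multilinear_le_of_forall_le ⟨hx.trans hz.1, hz.2.trans hy⟩ fun R => by
      have := h0 (insert p R)
      have := hM (R.erase p)
      simp only [marginal, Pi.neg_apply]
      linarith
  have := multilinear_le_add_sum_of_marginal_le hxy marginal_neg_le
  rw [map_neg, map_neg, ← Finset.sum_mul] at this
  linarith

theorem IsSubmodular.multilinear_le_add_sum {g : Finset P → ℝ} (hsub : IsSubmodular g)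
    {x y : P → ℝ} (hx : 0 ≤ x) (hxy : x ≤ y) (hy : y ≤ 1) :
    multilinear y g ≤ multilinear x g + ∑ p, (y p - x p) * multilinear x (marginal g p) :=
  multilinear_le_add_sum_of_marginal_le hxy fun p _ hz =>
    multilinear_antitone (hsub.marginal_antitone p) hx hz.1 (hz.2.trans hy)

theorem add_sum_sub_le_multilinear {f : Finset P → ℝ} {M : ℝ} (hmono : Monotone f)
    (hM : ∀ p R, marginal f p R ≤ M) {x y : P → ℝ} (hx : 0 ≤ x) (hxy : x ≤ y) (hy : y ≤ 1) :
    multilinear x f + ∑ p, (y p - x p) * multilinear x (marginal f p)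
      - M / 2 * (∑ p, (y p - x p)) ^ 2 ≤ multilinear y f := by
  suffices h : ∀ s : Finset P,
      multilinear x f + ∑ p ∈ s, (y p - x p) * multilinear x (marginal f p)
        - M / 2 * (∑ p ∈ s, (y p - x p)) ^ 2 ≤ multilinear (s.piecewise y x) f by
    simpa using h Finset.univ
  intro s
  induction s using Finset.induction_on with
  | empty => simp
  | insert p s hp ih =>
    have hs : s.piecewise y x ∈ Set.Icc x y := s.piecewise_mem_Icc' hxy
    have hM0 : 0 ≤ M := (marginal_nonneg hmono p ∅).trans (hM p ∅)
    have sum_piecewise : ∑ q, (s.piecewise y x q - x q) = ∑ q ∈ s, (y q - x q) := by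
      rw [← Finset.sum_filter_add_sum_filter_not _ (· ∈ s)]
      simp +contextual [Finset.sum_congr]
    have derivative_le : multilinear x (marginal f p) ≤
        multilinear (s.piecewise y x) (marginal f p) + M * ∑ q ∈ s, (y q - x q) := by
      rw [← sum_piecewise]
      exact multilinear_le_add_mul_sum_sub (marginal_nonneg hmono p) (hM p) hx hs.1
        (hs.2.trans hy)
    rw [multilinear_piecewise_insert x y f hp, Finset.sum_insert hp, Finset.sum_insert hp]
    have hp0 : 0 ≤ y p - x p := sub_nonneg.2 (hxy p)
    nlinarith [mul_le_mul_of_nonneg_left derivative_le hp0, mul_nonneg hM0 (sq_nonneg (y p - x p))]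

theorem IsSubmodular.le_multilinear_add_sum_marginal {f : Finset P → ℝ} (hsub : IsSubmodular f)
    (hmono : Monotone f) {x : P → ℝ} (hx : x ∈ Set.Icc 0 1) (S : Finset P) :
    f S ≤ multilinear x f + ∑ p ∈ S, multilinear x (marginal f p) := by
  rw [← map_sum, ← map_add]
  refine le_multilinear_of_forall_le hx fun R => ?_
  rw [Pi.add_apply, Finset.sum_apply]
  exact (hmono Finset.subset_union_right).trans (hsub.union_le_add_sum_marginal hmono R S)

end Multilinear

/-! ### Finite random variables -/

section Mean

variable {X Y : Type*} [Fintype X] [Fintype Y]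

/-- The expectation of `h` under a law on a finite type, written as a finite sum so that no
measurable structure is needed. -/
def mean (ν : PMF X) (h : X → ℝ) : ℝ := ∑ a, (ν a).toReal * h a

theorem mean_mono (ν : PMF X) : Monotone (mean ν) := fun _ _ hgh =>
  Finset.sum_le_sum fun a _ => mul_le_mul_of_nonneg_left (hgh a) ENNReal.toReal_nonneg

theorem mean_const (ν : PMF X) (c : ℝ) : mean ν (fun _ => c) = c := by
  rw [mean, ← Finset.sum_mul, ← ENNReal.toReal_sum fun a _ => ν.apply_ne_top a,
    ← tsum_fintype (L := SummationFilter.unconditional _), ν.tsum_coe, ENNReal.toReal_one, one_mul]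

theorem mean_map (ν : PMF X) (φ : X → Y) (g : Y → ℝ) : mean (ν.map φ) g = mean ν (g ∘ φ) := by
  let _ : MeasurableSpace X := ⊤
  let _ : MeasurableSpace Y := ⊤
  have mean_eq_integral := PMF.integral_eq_sum ν (g ∘ φ)
  have mean_map_eq_integral := PMF.integral_eq_sum (ν.map φ) g
  rw [← PMF.toMeasure_map _ _ measurable_from_top,
    MeasureTheory.integral_map measurable_from_top.aemeasurable
      measurable_from_top.aestronglyMeasurable] at mean_map_eq_integral
  exact mean_map_eq_integral.symm.trans mean_eq_integral

theorem mean_randomSet {P : Type*} [Fintype P] [DecidableEq P] {x : P → ℝ} (hx : x ∈ Set.Icc 0 1)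
    (g : Finset P → ℝ) : mean (randomSet x) g = multilinear x g := by
  have clip_eq : ∀ p, clip (x p) = x p := fun p => by
    have hp0 : 0 ≤ x p := hx.1 p
    have hp1 : x p ≤ 1 := hx.2 p
    rw [clip, min_eq_right hp1, max_eq_right hp0]
  rw [multilinear_apply]
  refine Finset.sum_congr rfl fun R _ => ?_
  rw [randomSet, PMF.ofFintype_apply]
  simp only [clip_eq]
  rw [← inclusionWeight, ENNReal.toReal_ofReal (inclusionWeight_nonneg hx R)]

end Mean

section Indep

variable {ι : Type*} [Fintype ι] [DecidableEq ι] {X : ι → Type*} [∀ i, Fintype (X i)]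
  (μ : ∀ i, PMF (X i))

theorem indep_toOuterMeasure_pi (s : ∀ i, Set (X i)) :
    (indep μ).toOuterMeasure (Set.univ.pi s) = ∏ i, (μ i).toOuterMeasure (s i) := by
  classical
  simp only [PMF.toOuterMeasure_apply_fintype]
  rw [Fintype.prod_sum]
  refine Finset.sum_congr rfl fun x _ => ?_
  by_cases hx : x ∈ Set.univ.pi s
  · rw [Set.indicator_of_mem hx]
    exact Finset.prod_congr rfl fun i _ => (Set.indicator_of_mem (hx i trivial) _).symm
  · obtain ⟨i, hi⟩ : ∃ i, x i ∉ s i := by simpa [Set.mem_univ_pi] using hx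
    rw [Set.indicator_of_notMem hx,
      Finset.prod_eq_zero (Finset.mem_univ i) (Set.indicator_of_notMem hi _)]

theorem indep_toMeasure [∀ i, MeasurableSpace (X i)] [∀ i, MeasurableSingletonClass (X i)] :
    (indep μ).toMeasure = MeasureTheory.Measure.pi fun i => (μ i).toMeasure := by
  refine (MeasureTheory.Measure.pi_eq fun s _ => ?_).symm
  simp only [PMF.toMeasure_apply_eq_toOuterMeasure, indep_toOuterMeasure_pi]

theorem mean_indep_update (j : ι) (H : (∀ i, X i) → ℝ) :
    mean (indep μ) (fun s => mean (μ j) fun a => H (Function.update s j a)) =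
      mean (indep μ) H := by
  have toReal_eq : ∀ s, (indep μ s).toReal =
      (μ j (s j)).toReal * ∏ i ∈ Finset.univ.erase j, (μ i (s i)).toReal := fun s => by
    rw [Finset.mul_prod_erase _ (fun i => (μ i (s i)).toReal) (Finset.mem_univ j),
      ← ENNReal.toReal_prod]
    rfl
  -- Exchanging the `j`-th coordinate with the fresh draw preserves the product law.
  let swap : (∀ i, X i) × X j → (∀ i, X i) × X j := fun u => (Function.update u.1 j u.2, u.1 j)
  have swap_involutive : Function.Involutive swap := fun u => by simp [swap]
  have sum_swap : ∑ u : (∀ i, X i) × X j,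
        (indep μ u.1).toReal * (μ j u.2).toReal * H (Function.update u.1 j u.2) =
      ∑ u : (∀ i, X i) × X j, (indep μ u.1).toReal * (μ j u.2).toReal * H u.1 := by
    refine Fintype.sum_equiv swap_involutive.toPerm _ _ fun u => ?_
    have prod_erase_eq : ∏ i ∈ Finset.univ.erase j, (μ i (Function.update u.1 j u.2 i)).toReal =
        ∏ i ∈ Finset.univ.erase j, (μ i (u.1 i)).toReal :=
      Finset.prod_congr rfl fun i hi => by
        rw [Function.update_of_ne (Finset.ne_of_mem_erase hi)]
    simp only [Function.Involutive.coe_toPerm, swap, toReal_eq, prod_erase_eq,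
      Function.update_self]
    ring
  calc mean (indep μ) (fun s => mean (μ j) fun a => H (Function.update s j a))
      = mean (indep μ) (fun s => mean (μ j) fun _ => H s) := by
        simpa only [mean, Fintype.sum_prod_type, Finset.mul_sum, mul_assoc] using sum_swap
    _ = mean (indep μ) H := by simp only [mean_const]

end Indep

/-! ### Concentration of the estimates -/

section Concentration

theorem one_sub_le_toOuterMeasure {X : Type*} (μ : PMF X) (s : Set X) {b : ENNReal}
    (hb : μ.toOuterMeasure sᶜ ≤ b) : 1 - b ≤ μ.toOuterMeasure s := by
  let _ : MeasurableSpace X := ⊤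
  have compl_le : μ.toMeasure sᶜ ≤ b := by rwa [PMF.toMeasure_apply_eq_toOuterMeasure]
  have add_compl : μ.toMeasure s + μ.toMeasure sᶜ = 1 :=
    MeasureTheory.prob_add_prob_compl MeasurableSet.of_discrete
  rw [← PMF.toMeasure_apply_eq_toOuterMeasure, ← add_compl, tsub_le_iff_right]
  gcongr

theorem hasSubgaussianMGF_sum_indep {ι X : Type*} [Fintype ι] [DecidableEq ι] [Fintype X]
    [MeasurableSpace X] [MeasurableSingletonClass X] (ν : PMF X) {h : X → ℝ} {a b : ℝ}
    (hh : ∀ x, h x ∈ Set.Icc a b) :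
    ProbabilityTheory.HasSubgaussianMGF (fun R : ι → X => ∑ j, (h (R j) - mean ν h))
      (∑ _ : ι, (‖b - a‖₊ / 2) ^ 2) (indep fun _ : ι => ν).toMeasure := by
  have hmeas : Measurable h := measurable_of_countable h
  have mean_eq (j : ι) :
      mean ν h = ∫ R : ι → X, h (R j) ∂MeasureTheory.Measure.pi fun _ => ν.toMeasure := by
    rw [MeasureTheory.integral_comp_eval (μ := fun _ : ι => ν.toMeasure)
      hmeas.aestronglyMeasurable, PMF.integral_eq_sum]
    rfl
  rw [indep_toMeasure]
  refine .sum_of_iIndepFun (ProbabilityTheory.iIndepFun_pi (X := fun _ x => h x - mean ν h)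
    fun _ => (hmeas.sub_const _).aemeasurable) fun j _ => ?_
  rw [mean_eq j]
  exact ProbabilityTheory.hasSubgaussianMGF_of_mem_Icc
    (hmeas.comp (measurable_pi_apply j)).aemeasurable (.of_forall fun R => hh (R j))

theorem toMeasure_le_abs_sum_sub_mean_le {ι X : Type*} [Fintype ι] [DecidableEq ι] [Fintype X]
    [MeasurableSpace X] [MeasurableSingletonClass X] (ν : PMF X) {h : X → ℝ} {a b : ℝ}
    (hh : ∀ x, h x ∈ Set.Icc a b) {δ : ℝ} (hδ : 0 ≤ δ) :
    (indep fun _ : ι => ν).toMeasure {R | δ ≤ |∑ j, (h (R j) - mean ν h)|} ≤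
      ENNReal.ofReal (2 * Real.exp (-2 * δ ^ 2 / (Fintype.card ι * (b - a) ^ 2))) := by
  let Z : (ι → X) → ℝ := fun R => ∑ j, (h (R j) - mean ν h)
  have hZ := hasSubgaussianMGF_sum_indep (ι := ι) ν hh
  have exponent_eq : -δ ^ 2 / (2 * ((∑ _ : ι, (‖b - a‖₊ / 2) ^ 2 : NNReal) : ℝ)) =
      -2 * δ ^ 2 / (Fintype.card ι * (b - a) ^ 2) := by
    push_cast
    rw [Finset.sum_const, Finset.card_univ, nsmul_eq_mul, div_pow, Real.norm_eq_abs, sq_abs]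
    field
  have upper_tail := hZ.measure_ge_le hδ
  have lower_tail := hZ.neg.measure_ge_le hδ
  rw [exponent_eq] at upper_tail lower_tail
  rw [← MeasureTheory.ofReal_measureReal]
  refine ENNReal.ofReal_le_ofReal ?_
  have abs_tail : {R | δ ≤ |Z R|} = {R | δ ≤ Z R} ∪ {R | δ ≤ (-Z) R} := by
    ext R
    exact le_abs (b := Z R)
  rw [abs_tail, two_mul]
  exact (MeasureTheory.measureReal_union_le _ _).trans (add_le_add upper_tail lower_tail)

theorem toOuterMeasure_lt_abs_average_sub_mean_le {ι X : Type*} [Fintype ι] [DecidableEq ι]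
    [Fintype X] (ν : PMF X) {h : X → ℝ} {a b : ℝ} (hh : ∀ x, h x ∈ Set.Icc a b) {η : ℝ}
    (hη : 0 ≤ η) :
    (indep fun _ : ι => ν).toOuterMeasure
        {R | η * (b - a) < |(∑ j, h (R j)) / Fintype.card ι - mean ν h|} ≤
      ENNReal.ofReal (2 * Real.exp (-2 * η ^ 2 * Fintype.card ι)) := by
  let _ : MeasurableSpace X := ⊤
  rw [← PMF.toMeasure_apply_eq_toOuterMeasure]
  rcases isEmpty_or_nonempty ι with hι | hι
  · refine MeasureTheory.prob_le_one.trans ?_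
    simp
  obtain ⟨x, -⟩ := ν.support_nonempty
  rcases ((hh x).1.trans (hh x).2).eq_or_lt with rfl | hab
  · obtain rfl : h = fun _ => a := funext fun y => le_antisymm (hh y).2 (hh y).1
    simp [mean_const]
  have hn : (0 : ℝ) < Fintype.card ι := by exact_mod_cast Fintype.card_pos
  have sum_sub_eq (R : ι → X) : ∑ j, (h (R j) - mean ν h) =
      Fintype.card ι * ((∑ j, h (R j)) / Fintype.card ι - mean ν h) := by
    rw [Finset.sum_sub_distrib, Finset.sum_const, Finset.card_univ, nsmul_eq_mul]
    field_simp
  have hδ : 0 ≤ Fintype.card ι * (η * (b - a)) :=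
    mul_nonneg hn.le (mul_nonneg hη (sub_nonneg.2 hab.le))
  refine (MeasureTheory.measure_mono fun R hR => ?_).trans
    ((toMeasure_le_abs_sum_sub_mean_le ν hh hδ).trans_eq ?_)
  · simp only [Set.mem_ofPred_eq] at hR ⊢
    rw [sum_sub_eq, abs_mul, abs_of_pos hn]
    exact mul_le_mul_of_nonneg_left hR.le hn.le
  · have : b - a ≠ 0 := (sub_pos.2 hab).ne'
    congr 3
    field_simp

theorem one_sub_pow_le_one_sub_mul_div_two {x : ℝ} (hx : 0 ≤ x) {m : ℕ} (hm : m * x ≤ 1) :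
    (1 - x) ^ m ≤ 1 - m * x / 2 := by
  rcases Nat.eq_zero_or_pos m with rfl | hm0
  · simp
  have hm1 : (1 : ℝ) ≤ m := by exact_mod_cast hm0
  have hmx : 0 ≤ m * x := by positivity
  have exp_neg_le : Real.exp (-(m * x)) ≤ 1 - m * x / 2 := by
    rw [Real.exp_neg, inv_le_iff_one_le_mul₀ (Real.exp_pos _)]
    nlinarith [Real.add_one_le_exp (m * x)]
  calc (1 - x) ^ m ≤ Real.exp (-x) ^ m :=
        pow_le_pow_left₀ (by nlinarith) (Real.one_sub_le_exp_neg x) m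
    _ = Real.exp (-(m * x)) := by rw [← Real.exp_nat_mul, mul_neg]
    _ ≤ 1 - m * x / 2 := exp_neg_le

theorem one_sub_two_mul_pow_le {d : ℝ} (hd : 0 ≤ d) {m : ℕ} (hm : 2 * m * d ≤ 1) :
    (1 - 2 * d) ^ m ≤ 1 - m * (2 * d ^ 4) := by
  rcases Nat.eq_zero_or_pos m with rfl | hm0
  · simp
  have hm1 : (1 : ℝ) ≤ m := by exact_mod_cast hm0
  have d_le : d ≤ 1 / 2 := by nlinarith
  have two_mul_pow_le : 2 * d ^ 4 ≤ d := by
    have : d ^ 3 ≤ (1 / 2) ^ 3 := pow_le_pow_left₀ hd d_le 3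
    nlinarith
  refine (one_sub_pow_le_one_sub_mul_div_two (x := 2 * d) (by positivity) (by linarith)).trans ?_
  nlinarith

theorem one_sub_two_mul_pow_nonneg {d : ℝ} {m : ℕ} (hm : 2 * m * d ≤ 1) :
    0 ≤ (1 - 2 * d) ^ m := by
  rcases Nat.eq_zero_or_pos m with rfl | hm0
  · simp
  have hm1 : (1 : ℝ) ≤ m := by exact_mod_cast hm0
  exact pow_nonneg (by nlinarith) m

variable {A P L : Type*} [Fintype A] [DecidableEq L] {Pol : A → Finset P} {T : ℕ}
  {K : A → ℕ} {β : P → L}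

/-- The factor that one time step contributes to the probability bound of the theorem: it bounds
the probability that all estimates of the step are accurate up to `M / (2 * T)`, where `M` bounds
the marginal gains. -/
noncomputable def accuracyProb (Pol : A → Finset P) (T : ℕ) (K : A → ℕ) : ℝ :=
  ∏ i, (1 - 2 * Real.exp (-(K i : ℝ) / (8 * (T : ℝ) ^ 2))) ^ (Pol i).card

theorem accuracyProb_nonneg
    (hK : ∀ i l, 2 * (((Pol i).filter fun p => β p = l).card : ℝ)
      * Real.exp (-(K i : ℝ) / (8 * (T : ℝ) ^ 2)) ≤ 1) : 0 ≤ accuracyProb Pol T K := by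
  refine Finset.prod_nonneg fun i _ => ?_
  rcases (Pol i).eq_empty_or_nonempty with hempty | ⟨p, hp⟩
  · simp [hempty]
  · have card_pos : (1 : ℝ) ≤ ((Pol i).filter fun q => β q = β p).card := by
      have : p ∈ (Pol i).filter fun q => β q = β p := Finset.mem_filter.2 ⟨hp, rfl⟩
      exact_mod_cast Finset.card_pos.2 ⟨p, this⟩
    exact pow_nonneg
      (by nlinarith [hK i (β p), Real.exp_pos (-(K i : ℝ) / (8 * (T : ℝ) ^ 2))]) _

variable [Fintype L]

theorem accuracyProb_eq_prod_fiber (Pol : A → Finset P) (T : ℕ) (K : A → ℕ) (β : P → L) :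
    accuracyProb Pol T K = ∏ i, ∏ l, (1 - 2 * Real.exp (-(K i : ℝ) / (8 * (T : ℝ) ^ 2))) ^
      ((Pol i).filter fun p => β p = l).card := by
  refine Finset.prod_congr rfl fun i _ => ?_
  rw [Finset.prod_pow_eq_pow_sum, ← Finset.card_eq_sum_card_fiberwise (by simp)]

variable [Fintype P] [DecidableEq P]

theorem le_toOuterMeasure_forall_abs_estimate_sub_le {f : Finset P → ℝ} {M : ℝ}
    (hmono : Monotone f) (hM : ∀ p R, marginal f p R ≤ M) {x : P → ℝ} (hx : x ∈ Set.Icc 0 1)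
    {η : ℝ} (hη : 0 ≤ η) (k : ℕ) (Q : Finset P) :
    ENNReal.ofReal (1 - Q.card * (2 * Real.exp (-2 * η ^ 2 * k))) ≤
      (indep fun _ : Fin k => randomSet x).toOuterMeasure
        {R | ∀ p ∈ Q, |estimate f R p - multilinear x (marginal f p)| ≤ η * M} := by
  have inaccurate_le (p : P) : (indep fun _ : Fin k => randomSet x).toOuterMeasure
      {R | η * M < |estimate f R p - multilinear x (marginal f p)|} ≤
      ENNReal.ofReal (2 * Real.exp (-2 * η ^ 2 * k)) := by
    simpa only [estimate, marginal, mean_randomSet hx, sub_zero, Fintype.card_fin] using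
      toOuterMeasure_lt_abs_average_sub_mean_le (ι := Fin k) (randomSet x)
        (fun R => ⟨marginal_nonneg hmono p R, hM p R⟩) hη
  rw [ENNReal.ofReal_sub _ (by positivity), ENNReal.ofReal_one]
  refine one_sub_le_toOuterMeasure _ _ ?_
  calc _ ≤ (indep fun _ : Fin k => randomSet x).toOuterMeasure
        (⋃ p ∈ Q, {R | η * M < |estimate f R p - multilinear x (marginal f p)|}) :=
        MeasureTheory.measure_mono fun R hR => by simpa using hR
    _ ≤ ∑ p ∈ Q, ENNReal.ofReal (2 * Real.exp (-2 * η ^ 2 * k)) :=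
        (MeasureTheory.measure_biUnion_finset_le _ _).trans
          (Finset.sum_le_sum fun p _ => inaccurate_le p)
    _ = ENNReal.ofReal (Q.card * (2 * Real.exp (-2 * η ^ 2 * k))) := by
        rw [Finset.sum_const, nsmul_eq_mul, ENNReal.ofReal_mul (Nat.cast_nonneg _),
          ENNReal.ofReal_natCast]

/-- Every estimate of a marginal gain made from the samples `ω` in the state `F` is within `ε` of
its expected value. -/
def IsAccurate (f : Finset P → ℝ) (Pol : A → Finset P) {K : A → ℕ} (β : P → L) (ε : ℝ)
    (F : A → Info P) (ω : Samples P L K) : Prop :=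
  ∀ i, ∀ p ∈ Pol i, |estimate f (ω i (β p)) p - multilinear (F i).prob (marginal f p)| ≤ ε

theorem accuracyProb_le_drawSamples [DecidableEq A] {f : Finset P → ℝ} {M : ℝ}
    (hmono : Monotone f) (hM : ∀ p R, marginal f p R ≤ M) {F : A → Info P}
    (hF : ∀ i, (F i).prob ∈ Set.Icc 0 1)
    (hK : ∀ i l, 2 * (((Pol i).filter fun p => β p = l).card : ℝ)
      * Real.exp (-(K i : ℝ) / (8 * (T : ℝ) ^ 2)) ≤ 1) :
    ENNReal.ofReal (accuracyProb Pol T K) ≤ (drawSamples (L := L) K F).toOuterMeasure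
      {ω | IsAccurate f Pol β (1 / (2 * T) * M) F ω} := by
  have event_eq : {ω : Samples P L K | IsAccurate f Pol β (1 / (2 * T) * M) F ω} =
      Set.univ.pi fun i => Set.univ.pi fun l => {R | ∀ p ∈ (Pol i).filter fun p => β p = l,
        |estimate f R p - multilinear (F i).prob (marginal f p)| ≤ 1 / (2 * T) * M} := by
    ext ω
    simp only [IsAccurate, Set.mem_univ_pi, Set.mem_ofPred_eq, Finset.mem_filter]
    exact ⟨fun h i l p hp => hp.2 ▸ h i p hp.1, fun h i p hp => h i (β p) p ⟨hp, rfl⟩⟩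
  rw [event_eq, drawSamples, indep_toOuterMeasure_pi, accuracyProb_eq_prod_fiber Pol T K β,
    ENNReal.ofReal_prod_of_nonneg fun i _ => Finset.prod_nonneg fun l _ =>
      one_sub_two_mul_pow_nonneg (hK i l)]
  refine Finset.prod_le_prod' fun i _ => ?_
  rw [indep_toOuterMeasure_pi,
    ENNReal.ofReal_prod_of_nonneg fun l _ => one_sub_two_mul_pow_nonneg (hK i l)]
  refine Finset.prod_le_prod' fun l _ => ?_
  refine (ENNReal.ofReal_le_ofReal ?_).trans
    (le_toOuterMeasure_forall_abs_estimate_sub_le hmono hM (hF i) (by positivity) (K i) _)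
  have exponent_eq : Real.exp (-2 * (1 / (2 * (T : ℝ))) ^ 2 * K i) =
      Real.exp (-(K i : ℝ) / (8 * (T : ℝ) ^ 2)) ^ 4 := by
    rw [← Real.exp_nat_mul]
    congr 1
    push_cast
    ring
  rw [exponent_eq]
  exact one_sub_two_mul_pow_le (Real.exp_pos _).le (hK i l)

theorem mul_le_toOuterMeasure_bind {X Y : Type*} (μ : PMF X) (κ : X → PMF Y) {s : Set X}
    {t : Set Y} {q : ENNReal}
    (hq : ∀ a ∈ μ.support, a ∈ s → q ≤ (κ a).toOuterMeasure t) :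
    μ.toOuterMeasure s * q ≤ (μ.bind κ).toOuterMeasure t := by
  rw [PMF.toOuterMeasure_bind_apply, PMF.toOuterMeasure_apply, ← ENNReal.tsum_mul_right]
  refine ENNReal.tsum_le_tsum fun a => ?_
  by_cases ha : a ∈ s ∩ μ.support
  · rw [Set.indicator_of_mem ha.1]
    gcongr
    exact hq a ha.2 ha.1
  · have indicator_eq : s.indicator μ a = 0 := by
      rw [Set.indicator_apply_eq_zero]
      exact fun has => by_contra fun h0 => ha ⟨has, h0⟩
    rw [indicator_eq, zero_mul]
    exact zero_le

end Concentration

/-! ### Updates and maxima of information sets -/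

section InformationSets

variable {P ι : Type*}

/-- The information sets that occur in the algorithm: at most one pair per policy, and only
nonnegative values. -/
structure Info.Lawful (F : Info P) : Prop where
  unique : ∀ p a b, (p, a) ∈ F → (p, b) ∈ F → a = b
  nonneg : ∀ p a, (p, a) ∈ F → 0 ≤ a

theorem Info.lawful_empty : Info.Lawful (∅ : Info P) := ⟨by simp, by simp⟩

section Max

variable {s : Finset ι} {F : ι → Info P}

theorem Info.mem_max {p : P} {a : ℝ} :
    (p, a) ∈ Info.max s F ↔ (∃ i ∈ s, (p, a) ∈ F i) ∧ ∀ c, (∃ i ∈ s, (p, c) ∈ F i) → c ≤ a := by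
  simp [Info.max]

theorem Info.lawful_max (hF : ∀ i, (F i).Lawful) : (Info.max s F).Lawful := by
  refine ⟨fun p a b ha hb => ?_, fun p a ha => ?_⟩
  · rw [mem_max] at ha hb
    exact le_antisymm (hb.2 a ha.1) (ha.2 b hb.1)
  · obtain ⟨⟨i, -, hi⟩, -⟩ := mem_max.1 ha
    exact (hF i).nonneg p a hi

theorem Info.exists_mem_max {p : P} {a : ℝ} {i : ι} (hi : i ∈ s) (ha : (p, a) ∈ F i) :
    ∃ b, (p, b) ∈ Info.max s F := by
  classical
  obtain ⟨⟨q, b⟩, hqb, hmax⟩ := ((s.biUnion F).filter fun u => u.1 = p).exists_max_image Prod.snd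
    ⟨(p, a), by simpa using ⟨i, hi, ha⟩⟩
  simp only [Finset.mem_filter, Finset.mem_biUnion] at hqb hmax
  obtain ⟨hqb, rfl⟩ := hqb
  exact ⟨b, mem_max.2 ⟨hqb, fun c hc => hmax (q, c) ⟨hc, rfl⟩⟩⟩

end Max

variable [DecidableEq P]

theorem Info.prob_of_mem {F : Info P} (hF : F.Lawful) {p : P} {a : ℝ} (ha : (p, a) ∈ F) :
    F.prob p = a := by
  rw [Info.prob, Finset.sum_eq_single_of_mem (p, a) (by simpa using ha)]
  rintro ⟨q, b⟩ hb hne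
  simp only [Finset.mem_filter] at hb
  obtain ⟨hb, rfl⟩ := hb
  exact absurd (by rw [hF.unique _ _ _ hb ha]) hne

theorem Info.prob_of_notMem {F : Info P} {p : P} (h : ∀ a, (p, a) ∉ F) : F.prob p = 0 := by
  refine Finset.sum_eq_zero fun ⟨q, a⟩ ha => ?_
  simp only [Finset.mem_filter] at ha
  obtain ⟨ha, rfl⟩ := ha
  exact absurd ha (h a)

theorem Info.Lawful.prob_nonneg {F : Info P} (hF : F.Lawful) (p : P) : 0 ≤ F.prob p := by
  by_cases h : ∃ a, (p, a) ∈ F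
  · obtain ⟨a, ha⟩ := h
    rw [prob_of_mem hF ha]
    exact hF.nonneg p a ha
  · rw [prob_of_notMem (not_exists.1 h)]

theorem Info.mem_add {F : Info P} {p q : P} {a c : ℝ} :
    (q, c) ∈ F.add p a ↔ (q ≠ p ∧ (q, c) ∈ F) ∨ (q = p ∧ ∃ b, (p, b) ∈ F ∧ c = b + a) ∨
      (q = p ∧ c = a ∧ ∀ b, (p, b) ∉ F) := by
  by_cases h : ∃ b, (p, b) ∈ F
  · simp only [Info.add, h, if_true, Finset.mem_union, Finset.mem_filter, Finset.mem_image,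
      Finset.notMem_empty]
    grind
  · simp only [Info.add, h, if_false, Finset.mem_union, Finset.mem_filter, Finset.mem_image,
      Finset.mem_singleton]
    grind

theorem Info.Lawful.add {F : Info P} (hF : F.Lawful) (p : P) {a : ℝ} (ha : 0 ≤ a) :
    (F.add p a).Lawful := by
  refine ⟨fun q b c hb hc => ?_, fun q b hb => ?_⟩
  · rw [Info.mem_add] at hb hc
    have := hF.unique
    grind
  · rw [Info.mem_add] at hb
    rcases hb with ⟨-, hqb⟩ | ⟨-, c, hpc, rfl⟩ | ⟨-, rfl, -⟩
    exacts [hF.nonneg q b hqb, add_nonneg (hF.nonneg p c hpc) ha, ha]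

theorem Info.Lawful.prob_add {F : Info P} (hF : F.Lawful) (p : P) {a : ℝ} (ha : 0 ≤ a) (q : P) :
    (F.add p a).prob q = F.prob q + if q = p then a else 0 := by
  have hFa := hF.add p ha
  by_cases h : ∃ b, (q, b) ∈ F
  · obtain ⟨b, hb⟩ := h
    rw [prob_of_mem hF hb]
    split_ifs with hq
    · subst hq
      exact prob_of_mem hFa (mem_add.2 (.inr (.inl ⟨rfl, b, hb, rfl⟩)))
    · rw [add_zero]
      exact prob_of_mem hFa (mem_add.2 (.inl ⟨hq, hb⟩))
  · have hq_notMem := not_exists.1 h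
    rw [prob_of_notMem hq_notMem, zero_add]
    split_ifs with hq
    · subst hq
      exact prob_of_mem hFa (mem_add.2 (.inr (.inr ⟨rfl, rfl, hq_notMem⟩)))
    · refine prob_of_notMem fun c hc => ?_
      rcases mem_add.1 hc with hc | hc | hc
      exacts [hq_notMem c hc.2, hq hc.1, hq hc.1]

variable {s : Finset ι} {F : ι → Info P}

theorem Info.prob_le_prob_max (hF : ∀ i, (F i).Lawful) {i : ι} (hi : i ∈ s) (p : P) :
    (F i).prob p ≤ (Info.max s F).prob p := by
  by_cases h : ∃ a, (p, a) ∈ F i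
  · obtain ⟨a, ha⟩ := h
    obtain ⟨b, hb⟩ := exists_mem_max hi ha
    rw [prob_of_mem (hF i) ha, prob_of_mem (lawful_max hF) hb]
    exact (mem_max.1 hb).2 a ⟨i, hi, ha⟩
  · rw [prob_of_notMem (not_exists.1 h)]
    exact (lawful_max hF).prob_nonneg p

theorem Info.exists_prob_max_eq (hF : ∀ i, (F i).Lawful) (hs : s.Nonempty) (p : P) :
    ∃ i ∈ s, (Info.max s F).prob p = (F i).prob p := by
  by_cases h : ∃ a, (p, a) ∈ Info.max s F
  · obtain ⟨a, ha⟩ := h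
    obtain ⟨i, hi, hia⟩ := (mem_max.1 ha).1
    exact ⟨i, hi, by rw [prob_of_mem (lawful_max hF) ha, prob_of_mem (hF i) hia]⟩
  · obtain ⟨i, hi⟩ := hs
    refine ⟨i, hi, ?_⟩
    rw [prob_of_notMem (not_exists.1 h), prob_of_notMem fun a ha => h (exists_mem_max hi ha)]

end InformationSets

/-! ### The spread of information -/

section Ownership

variable {A P : Type*} {Pol : A → Finset P} {own : P → A}

/-- `own p` is the one agent that has the policy `p`, so the policy sets are the fibers of `own`. -/
def IsOwner (Pol : A → Finset P) (own : P → A) : Prop :=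
  ∀ i p, p ∈ Pol i ↔ own p = i

theorem exists_isOwner (hdisj : ∀ i j, i ≠ j → Disjoint (Pol i) (Pol j))
    (hcover : ∀ p, ∃ i, p ∈ Pol i) : ∃ own, IsOwner Pol own := by
  choose own hown using hcover
  refine ⟨own, fun i p => ⟨fun hp => ?_, fun h => h ▸ hown p⟩⟩
  by_contra hne
  exact Finset.disjoint_left.1 (hdisj _ _ hne) (hown p) hp

theorem IsOwner.sum_inter [Fintype A] [DecidableEq P] (hown : IsOwner Pol own) (S : Finset P)
    (g : P → ℝ) : ∑ i, ∑ p ∈ S ∩ Pol i, g p = ∑ p ∈ S, g p := by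
  classical
  rw [← Finset.sum_fiberwise S own g]
  refine Finset.sum_congr rfl fun i _ => Finset.sum_congr ?_ fun _ _ => rfl
  ext p
  rw [Finset.mem_inter, Finset.mem_filter, hown i p]

theorem IsOwner.sum_policies [Fintype A] [Fintype P] (hown : IsOwner Pol own) (g : P → ℝ) :
    ∑ i, ∑ p ∈ Pol i, g p = ∑ p, g p := by
  classical
  simpa only [Finset.univ_inter] using hown.sum_inter Finset.univ g

end Ownership

section Invariant

variable {A P L : Type*} [DecidableEq P] {Pol : A → Finset P} {own : P → A}

/-- The vector `y` of the probabilities that every agent assigns to its own policies. It is the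
point whose multilinear extension the algorithm increases. -/
def ownProb (own : P → A) (F : A → Info P) (p : P) : ℝ := (F (own p)).prob p

/-- The relations between the information sets of the agents after `t` time steps: each agent has
distributed the mass `t / T` over its own policies, and an agent at distance `ℓ` in the graph has
missed at most the last `ℓ` of these increments. -/
structure Invariant (G : SimpleGraph A) (Pol : A → Finset P) (own : P → A) (T t : ℕ)
    (F : A → Info P) : Prop where
  lawful : ∀ i, (F i).Lawful
  prob_le_ownProb : ∀ i, (F i).prob ≤ ownProb own F
  sum_ownProb : ∀ i, ∑ p ∈ Pol i, ownProb own F p = t * (1 / T)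
  lag_le : ∀ i j (w : G.Walk i j),
    ∑ p ∈ Pol j, (ownProb own F p - (F i).prob p) ≤ w.length * (1 / T)

namespace Invariant

variable {G : SimpleGraph A} {T t : ℕ} {F : A → Info P}

theorem zero : Invariant G Pol own T 0 fun _ => ∅ where
  lawful _ := Info.lawful_empty
  prob_le_ownProb _ _ := le_rfl
  sum_ownProb _ := by simp [ownProb, Info.prob]
  lag_le _ _ _ := by
    simp only [ownProb, sub_self, Finset.sum_const_zero]
    positivity

theorem prob_nonneg (h : Invariant G Pol own T t F) (i : A) : 0 ≤ (F i).prob :=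
  (h.lawful i).prob_nonneg

theorem ownProb_nonneg (h : Invariant G Pol own T t F) : 0 ≤ ownProb own F :=
  fun p => h.prob_nonneg (own p) p

theorem ownProb_le (h : Invariant G Pol own T t F) (hown : IsOwner Pol own) (p : P) :
    ownProb own F p ≤ t * (1 / T) := by
  rw [← h.sum_ownProb (own p)]
  exact Finset.single_le_sum (fun q _ => h.ownProb_nonneg q) ((hown _ p).2 rfl)

theorem ownProb_le_one (h : Invariant G Pol own T t F) (hown : IsOwner Pol own) (ht : t ≤ T) :
    ownProb own F ≤ 1 := fun p => by
  refine (h.ownProb_le hown p).trans ?_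
  rw [mul_one_div]
  exact div_le_one_of_le₀ (by exact_mod_cast ht) (Nat.cast_nonneg T)

theorem prob_mem_Icc (h : Invariant G Pol own T t F) (hown : IsOwner Pol own) (ht : t ≤ T)
    (i : A) : (F i).prob ∈ Set.Icc 0 1 :=
  ⟨h.prob_nonneg i, (h.prob_le_ownProb i).trans (h.ownProb_le_one hown ht)⟩

theorem sum_prob (h : Invariant G Pol own T t F) (hown : IsOwner Pol own) (i : A) :
    ∑ p ∈ Pol i, (F i).prob p = t * (1 / T) := by
  rw [← h.sum_ownProb i]
  refine Finset.sum_congr rfl fun p hp => ?_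
  rw [ownProb, (hown i p).1 hp]

theorem sum_lag_le [Fintype A] [Fintype P] (h : Invariant G Pol own T t F)
    (hown : IsOwner Pol own) (hG : G.Connected) (i : A) :
    ∑ p, (ownProb own F p - (F i).prob p) ≤ Fintype.card A * (G.diam * (1 / T)) := by
  have : Nonempty A := ⟨i⟩
  have agent_le (j : A) : ∑ p ∈ Pol j, (ownProb own F p - (F i).prob p) ≤ G.diam * (1 / T) := by
    obtain ⟨w, hw⟩ := hG.exists_walk_length_eq_dist i j
    refine (h.lag_le i j w).trans (mul_le_mul_of_nonneg_right ?_ (by positivity))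
    rw [hw]
    exact_mod_cast SimpleGraph.dist_le_diam (SimpleGraph.connected_iff_ediam_ne_top.1 hG)
  rw [← hown.sum_policies]
  calc _ ≤ ∑ _j : A, (G.diam : ℝ) * (1 / T) := Finset.sum_le_sum fun j _ => agent_le j
    _ = _ := by rw [Finset.sum_const, Finset.card_univ, nsmul_eq_mul]

end Invariant

variable {G : SimpleGraph A} {f : Finset P → ℝ} {T t : ℕ} {K : A → ℕ} {β : P → L}
  {sel : Selection Pol} {F : A → Info P}

/-- The policy that agent `i` selects in time step `t` on the samples `ω`. -/
noncomputable def selected (f : Finset P → ℝ) (β : P → L) (sel : Selection Pol) (t : ℕ)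
    (ω : Samples P L K) (i : A) : P :=
  sel t i fun p => estimate f (ω i (β p)) p

theorem selected_mem (ω : Samples P L K) (i : A) : selected f β sel t ω i ∈ Pol i :=
  Subtype.prop _

theorem IsOwner.own_selected (hown : IsOwner Pol own) (ω : Samples P L K) (i : A) :
    own (selected f β sel t ω i) = i :=
  (hown i _).1 (selected_mem ω i)

theorem IsOwner.eq_of_eq_selected (hown : IsOwner Pol own) {ω : Samples P L K} {p : P} {i : A}
    (h : p = selected f β sel t ω i) : own p = i :=
  h ▸ hown.own_selected ω i

section Propagate

variable (hF : ∀ i, (F i).Lawful) (ω : Samples P L K)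
include hF

theorem lawful_propagate (i : A) : (propagate Pol f T K β sel t F ω i).Lawful :=
  (hF i).add _ (by positivity)

theorem prob_propagate (i : A) (p : P) : (propagate Pol f T K β sel t F ω i).prob p =
    (F i).prob p + if p = selected f β sel t ω i then 1 / (T : ℝ) else 0 :=
  (hF i).prob_add _ (by positivity) p

theorem prob_le_prob_propagate (i : A) (p : P) :
    (F i).prob p ≤ (propagate Pol f T K β sel t F ω i).prob p := by
  rw [prob_propagate hF, le_add_iff_nonneg_right]
  split_ifs <;> positivity

theorem prob_propagate_le_prob_propagate_own (hown : IsOwner Pol own)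
    (hle : ∀ i, (F i).prob ≤ ownProb own F) (i : A) (p : P) :
    (propagate Pol f T K β sel t F ω i).prob p ≤
      (propagate Pol f T K β sel t F ω (own p)).prob p := by
  rcases eq_or_ne (own p) i with rfl | hi
  · exact le_rfl
  · rw [prob_propagate hF, if_neg (mt hown.eq_of_eq_selected hi), add_zero]
    exact (hle i p).trans (prob_le_prob_propagate hF ω (own p) p)

end Propagate

section Step

variable [Fintype A] [DecidableEq A]

omit [DecidableEq P] in
theorem mem_closedNbhd {i j : A} : j ∈ closedNbhd G i ↔ j = i ∨ G.Adj i j := by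
  simp [closedNbhd]

theorem prob_le_prob_step (hF : ∀ i, (F i).Lawful) (ω : Samples P L K) {i j : A}
    (hj : j ∈ closedNbhd G i) (p : P) :
    (F j).prob p ≤ (step G Pol f T K β sel t F ω i).prob p :=
  (prob_le_prob_propagate hF ω j p).trans (Info.prob_le_prob_max (lawful_propagate hF ω) hj p)

theorem prob_step_le_prob_propagate_own (hown : IsOwner Pol own) (hF : ∀ i, (F i).Lawful)
    (hle : ∀ i, (F i).prob ≤ ownProb own F) (ω : Samples P L K) (i : A) (p : P) :
    (step G Pol f T K β sel t F ω i).prob p ≤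
      (propagate Pol f T K β sel t F ω (own p)).prob p := by
  obtain ⟨k, -, hk⟩ := Info.exists_prob_max_eq (lawful_propagate hF ω)
    ⟨i, mem_closedNbhd (G := G).2 (.inl rfl)⟩ p
  exact hk.le.trans (prob_propagate_le_prob_propagate_own hF ω hown hle k p)

theorem ownProb_step (hown : IsOwner Pol own) (hF : ∀ i, (F i).Lawful)
    (hle : ∀ i, (F i).prob ≤ ownProb own F) (ω : Samples P L K) (p : P) :
    ownProb own (step G Pol f T K β sel t F ω) p =
      ownProb own F p + if p = selected f β sel t ω (own p) then 1 / (T : ℝ) else 0 := by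
  rw [ownProb, ownProb, ← prob_propagate hF]
  exact (prob_step_le_prob_propagate_own hown hF hle ω _ p).antisymm
    (Info.prob_le_prob_max (lawful_propagate hF ω) (mem_closedNbhd.2 (.inl rfl)) p)

omit [Fintype A] [DecidableEq A] in
theorem IsOwner.sum_policies_ite_selected (hown : IsOwner Pol own) (ω : Samples P L K) (i : A)
    (g : P → ℝ) : ∑ p ∈ Pol i, (if p = selected f β sel t ω (own p) then g p else 0) =
      g (selected f β sel t ω i) := by
  rw [Finset.sum_congr rfl fun p hp => by rw [(hown i p).1 hp], Finset.sum_ite_eq',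
    if_pos (selected_mem ω i)]

theorem Invariant.step (h : Invariant G Pol own T t F) (hown : IsOwner Pol own)
    (ω : Samples P L K) :
    Invariant G Pol own T (t + 1) (DistGreedy.step G Pol f T K β sel t F ω) where
  lawful _ := Info.lawful_max (lawful_propagate h.lawful ω)
  prob_le_ownProb i p := by
    rw [ownProb_step hown h.lawful h.prob_le_ownProb, ownProb, ← prob_propagate h.lawful]
    exact prob_step_le_prob_propagate_own hown h.lawful h.prob_le_ownProb ω i p
  sum_ownProb i := by
    simp only [ownProb_step hown h.lawful h.prob_le_ownProb, Finset.sum_add_distrib,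
      h.sum_ownProb, hown.sum_policies_ite_selected]
    push_cast
    ring
  lag_le i j w := by
    cases w with
    | nil =>
      refine (Finset.sum_eq_zero fun p hp => ?_).trans_le (by simp)
      rw [ownProb, (hown i p).1 hp, sub_self]
    | @cons _ k _ hik w =>
      calc _ ≤ ∑ p ∈ Pol j, ((ownProb own F p - (F k).prob p) +
            if p = selected f β sel t ω (own p) then 1 / (T : ℝ) else 0) := by
            refine Finset.sum_le_sum fun p _ => ?_
            rw [ownProb_step hown h.lawful h.prob_le_ownProb, add_sub_right_comm]
            gcongr
            exact prob_le_prob_step h.lawful ω (mem_closedNbhd.2 (.inr hik)) p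
        _ ≤ _ := by
            rw [Finset.sum_add_distrib, hown.sum_policies_ite_selected,
              SimpleGraph.Walk.length_cons]
            push_cast
            linarith [h.lag_le k j w]

theorem Invariant.of_mem_support [Fintype P] [Fintype L] [DecidableEq L]
    (hown : IsOwner Pol own) (hF : F ∈ (run G Pol f T K β sel t).support) :
    Invariant G Pol own T t F := by
  induction t generalizing F with
  | zero =>
    rw [run, PMF.mem_support_pure_iff] at hF
    exact hF ▸ Invariant.zero
  | succ t ih =>
    rw [run, PMF.mem_support_bind_iff] at hF
    obtain ⟨F', hF', hF⟩ := hF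
    obtain ⟨ω, -, rfl⟩ := (PMF.mem_support_map_iff _ _ _).1 hF
    exact (ih hF').step hown ω

end Step

end Invariant

/-! ### Progress in one time step -/

section Progress

variable {A P L : Type*} [DecidableEq P] [Fintype A] [Fintype P]
  {G : SimpleGraph A} {Pol : A → Finset P} {own : P → A} {f : Finset P → ℝ} {M ε : ℝ} {T t : ℕ}
  {K : A → ℕ} {β : P → L} {sel : Selection Pol} {F : A → Info P} {ω : Samples P L K}

/-- The total error of one time step divided by its length `1 / T`: `N ^ 2 * d * M / T` because the
agents know outdated probabilities, `N ^ 2 / 2 * M / T` from the second order term of the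
multilinear extension, and `N * M / T` because the marginal gains are estimated. -/
noncomputable def stepLoss (G : SimpleGraph A) (T : ℕ) (M : ℝ) : ℝ :=
  ((Fintype.card A : ℝ) ^ 2 * G.diam + (Fintype.card A : ℝ) ^ 2 / 2 + Fintype.card A)
    * (1 / (T : ℝ)) * M

namespace Invariant

theorem marginal_le_marginal_selected_add (h : Invariant G Pol own T t F)
    (hown : IsOwner Pol own) (hG : G.Connected) (hmono : Monotone f) (hsub : IsSubmodular f)
    (hM : ∀ p R, marginal f p R ≤ M) (hsel : sel.IsArgmax) (ht : t ≤ T)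
    (hω : IsAccurate f Pol β ε F ω) {i : A} {s : P} (hs : s ∈ Pol i) :
    multilinear (ownProb own F) (marginal f s) ≤
      multilinear (ownProb own F) (marginal f (selected f β sel t ω i)) +
        (M * (Fintype.card A * (G.diam * (1 / T))) + 2 * ε) := by
  set q := selected f β sel t ω i
  have hx := h.prob_nonneg i
  have hxy := h.prob_le_ownProb i
  have hy := h.ownProb_le_one hown ht
  have hM0 : 0 ≤ M := (marginal_nonneg hmono s ∅).trans (hM s ∅)
  have s_le : multilinear (ownProb own F) (marginal f s) ≤
      multilinear (F i).prob (marginal f s) :=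
    multilinear_antitone (hsub.marginal_antitone s) hx hxy hy
  have selected_le : multilinear (F i).prob (marginal f q) ≤
      multilinear (ownProb own F) (marginal f q) + M * ∑ p, (ownProb own F p - (F i).prob p) :=
    multilinear_le_add_mul_sum_sub (marginal_nonneg hmono q) (hM q) hx hxy hy
  have lag_le := mul_le_mul_of_nonneg_left (h.sum_lag_le hown hG i) hM0
  have estimate_le : estimate f (ω i (β s)) s ≤ estimate f (ω i (β q)) q :=
    hsel t i (fun p => estimate f (ω i (β p)) p) ⟨s, hs⟩
  have s_accurate := (abs_le.1 (hω i s hs)).1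
  have selected_accurate := (abs_le.1 (hω i q (selected_mem ω i))).2
  linarith

theorem sum_marginal_le_sum_marginal_selected_add (h : Invariant G Pol own T t F)
    (hown : IsOwner Pol own) (hG : G.Connected) (hmono : Monotone f) (hsub : IsSubmodular f)
    (hM : ∀ p R, marginal f p R ≤ M) (hsel : sel.IsArgmax) (ht : t ≤ T)
    (hω : IsAccurate f Pol β ε F ω) {S : Finset P} (hS : Admissible Pol S) :
    ∑ s ∈ S, multilinear (ownProb own F) (marginal f s) ≤
      ∑ i, multilinear (ownProb own F) (marginal f (selected f β sel t ω i)) +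
        Fintype.card A * (M * (Fintype.card A * (G.diam * (1 / T))) + 2 * ε) := by
  have agent_le (i : A) : ∑ s ∈ S ∩ Pol i, multilinear (ownProb own F) (marginal f s) ≤
      multilinear (ownProb own F) (marginal f (selected f β sel t ω i)) +
        (M * (Fintype.card A * (G.diam * (1 / T))) + 2 * ε) := by
    obtain ⟨s, hs, subset_singleton⟩ : ∃ s ∈ Pol i, S ∩ Pol i ⊆ {s} := by
      rcases (S ∩ Pol i).eq_empty_or_nonempty with hempty | ⟨s, hs⟩
      · exact ⟨selected f β sel t ω i, selected_mem ω i, hempty ▸ Finset.empty_subset _⟩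
      · exact ⟨s, (Finset.mem_inter.1 hs).2, fun r hr =>
          Finset.mem_singleton.2 (Finset.card_le_one.1 (hS i) r hr s hs)⟩
    calc _ ≤ ∑ s ∈ {s}, multilinear (ownProb own F) (marginal f s) :=
          Finset.sum_le_sum_of_subset_of_nonneg subset_singleton fun p _ _ =>
            le_multilinear_of_forall_le ⟨h.ownProb_nonneg, h.ownProb_le_one hown ht⟩
              (marginal_nonneg hmono p)
      _ = multilinear (ownProb own F) (marginal f s) := Finset.sum_singleton _ _
      _ ≤ _ := h.marginal_le_marginal_selected_add hown hG hmono hsub hM hsel ht hω hs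
  rw [← hown.sum_inter]
  refine (Finset.sum_le_sum fun i _ => agent_le i).trans_eq ?_
  rw [Finset.sum_add_distrib, Finset.sum_const, Finset.card_univ, nsmul_eq_mul]

variable [DecidableEq A]

theorem sum_ownProb_step_sub_mul (h : Invariant G Pol own T t F) (hown : IsOwner Pol own)
    (ω : Samples P L K) (g : P → ℝ) :
    ∑ p, (ownProb own (DistGreedy.step G Pol f T K β sel t F ω) p - ownProb own F p) * g p =
      1 / T * ∑ i, g (selected f β sel t ω i) := by
  simp only [ownProb_step hown h.lawful h.prob_le_ownProb, add_sub_cancel_left, ite_mul, zero_mul]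
  rw [← hown.sum_policies, Finset.mul_sum]
  exact Finset.sum_congr rfl fun i _ =>
    hown.sum_policies_ite_selected ω i fun p => 1 / (T : ℝ) * g p

theorem sub_multilinear_step_le (h : Invariant G Pol own T t F)
    (hown : IsOwner Pol own) (hG : G.Connected) (hmono : Monotone f) (hsub : IsSubmodular f)
    (hM : ∀ p R, marginal f p R ≤ M) (hsel : sel.IsArgmax) (ht : t + 1 ≤ T)
    (hω : IsAccurate f Pol β (1 / (2 * T) * M) F ω) {S : Finset P} (hS : Admissible Pol S) :
    f S - stepLoss G T M -
        multilinear (ownProb own (DistGreedy.step G Pol f T K β sel t F ω)) f ≤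
      (1 - 1 / T) * (f S - stepLoss G T M - multilinear (ownProb own F) f) := by
  set F' := DistGreedy.step G Pol f T K β sel t F ω
  have hy := h.ownProb_le_one hown (Nat.le_of_succ_le ht)
  have hyy' : ownProb own F ≤ ownProb own F' := fun p => by
    rw [ownProb_step hown h.lawful h.prob_le_ownProb, le_add_iff_nonneg_right]
    split_ifs <;> positivity
  have sum_sub : ∑ p, (ownProb own F' p - ownProb own F p) = 1 / T * Fintype.card A := by
    simpa using h.sum_ownProb_step_sub_mul hown ω fun _ => 1
  have taylor := add_sum_sub_le_multilinear hmono hM h.ownProb_nonneg hyy'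
    ((h.step hown ω).ownProb_le_one hown ht)
  rw [h.sum_ownProb_step_sub_mul hown, sum_sub] at taylor
  have gap_le := (hsub.le_multilinear_add_sum_marginal hmono ⟨h.ownProb_nonneg, hy⟩ S).trans
    (add_le_add_right (h.sum_marginal_le_sum_marginal_selected_add hown hG hmono hsub hM hsel
      (Nat.le_of_succ_le ht) hω hS) _)
  have scaled_gap_le := mul_le_mul_of_nonneg_left gap_le (by positivity : (0 : ℝ) ≤ 1 / T)
  rw [stepLoss]
  have estimate_error : 2 * (1 / (2 * (T : ℝ)) * M) = 1 / T * M := by ring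
  rw [estimate_error] at scaled_gap_le
  linarith

end Invariant

theorem accuracyProb_pow_le_run [DecidableEq A] [Fintype L] [DecidableEq L]
    (hown : IsOwner Pol own) (hG : G.Connected) (hmono : Monotone f) (hsub : IsSubmodular f)
    (hM : ∀ p R, marginal f p R ≤ M) (hsel : sel.IsArgmax)
    (hK : ∀ i l, 2 * (((Pol i).filter fun p => β p = l).card : ℝ)
      * Real.exp (-(K i : ℝ) / (8 * (T : ℝ) ^ 2)) ≤ 1)
    {S : Finset P} (hS : Admissible Pol S) (ht : t ≤ T) :
    ENNReal.ofReal (accuracyProb Pol T K) ^ t ≤ (run G Pol f T K β sel t).toOuterMeasure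
      {F | f S - stepLoss G T M - multilinear (ownProb own F) f ≤
        (1 - 1 / T) ^ t * (f S - stepLoss G T M - f ∅)} := by
  induction t with
  | zero =>
    have ownProb_empty : (ownProb own fun _ : A => (∅ : Info P)) = 0 := by
      ext p
      simp [ownProb, Info.prob]
    simp [run, PMF.toOuterMeasure_pure_apply, ownProb_empty, multilinear_zero]
  | succ t ih =>
    have contraction_nonneg : (0 : ℝ) ≤ 1 - 1 / T := by
      rw [sub_nonneg, one_div]
      exact Nat.cast_inv_le_one T
    rw [run, pow_succ]
    refine (mul_le_mul_left (ih (Nat.le_of_succ_le ht)) _).trans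
      (mul_le_toOuterMeasure_bind _ _ fun F hF gap_le => ?_)
    have h := Invariant.of_mem_support hown hF
    rw [PMF.toOuterMeasure_map_apply]
    refine (accuracyProb_le_drawSamples hmono hM (h.prob_mem_Icc hown (Nat.le_of_succ_le ht))
      hK).trans (MeasureTheory.measure_mono fun ω hω => ?_)
    refine (h.sub_multilinear_step_le hown hG hmono hsub hM hsel ht hω hS).trans ?_
    rw [pow_succ', mul_assoc]
    exact mul_le_mul_of_nonneg_left gap_le contraction_nonneg

end Progress

/-! ### Rounding -/

section Rounding

variable {A P : Type*} [Fintype P] [DecidableEq P]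

theorem multilinear_marginal_of_eq_zero {y : P → ℝ} {p : P} (hy : y p = 0) (g : Finset P → ℝ) :
    multilinear y (marginal g p) = multilinear y (fun R => g (R ∪ {p})) - multilinear y g := by
  rw [← multilinear_comp_erase hy g, ← map_sub]
  congr 1
  ext R
  rw [marginal, Pi.sub_apply, Finset.insert_eq, Finset.union_comm]

theorem IsSubmodular.multilinear_le_sum_mul_multilinear_union_singleton {g : Finset P → ℝ}
    (hg : IsSubmodular g) {x : P → ℝ} (hx : x ∈ Set.Icc 0 1) {Q : Finset P}
    (hsum : ∑ p ∈ Q, x p = 1) :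
    multilinear x g ≤
      ∑ p ∈ Q, x p * multilinear (Q.piecewise (0 : P → ℝ) x) fun R => g (R ∪ {p}) := by
  set y := Q.piecewise (0 : P → ℝ) x with hy
  have hyQ {p : P} (hp : p ∈ Q) : y p = 0 := Finset.piecewise_eq_of_mem _ _ _ hp
  have hyx : y ≤ x := Finset.piecewise_le_of_le_of_le _ hx.1 le_rfl
  have hy0 : 0 ≤ y := Finset.le_piecewise_of_le_of_le _ le_rfl hx.1
  calc multilinear x g
      ≤ multilinear y g + ∑ p, (x p - y p) * multilinear y (marginal g p) :=
        hg.multilinear_le_add_sum hy0 hyx hx.2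
    _ = multilinear y g + ∑ p ∈ Q, x p *
          (multilinear y (fun R => g (R ∪ {p})) - multilinear y g) := by
        congr 1
        rw [← Finset.sum_subset (Finset.subset_univ Q) fun p _ hp => by
          rw [hy, Finset.piecewise_eq_of_notMem _ _ _ hp, sub_self, zero_mul]]
        exact Finset.sum_congr rfl fun p hp => by
          rw [multilinear_marginal_of_eq_zero (hyQ hp), hyQ hp, sub_zero]
    _ = ∑ p ∈ Q, x p * multilinear y fun R => g (R ∪ {p}) := by
        simp only [mul_sub, Finset.sum_sub_distrib]
        rw [← Finset.sum_mul, hsum]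
        ring

variable [Fintype A] [DecidableEq A] {Pol : A → Finset P} {own : P → A} {f : Finset P → ℝ}
  {x : P → ℝ} {μ : A → PMF (Finset P)}

/-- The expected value of `f` when the agents in `B` draw their sets from `μ`, whereas the policies
of all other agents are included independently with the probabilities `x`. Letting `B` grow
interpolates between the multilinear extension and the output of the algorithm. -/
noncomputable def hybridUtility (own : P → A) (f : Finset P → ℝ) (x : P → ℝ)
    (μ : A → PMF (Finset P)) (B : Finset A) : ℝ :=
  mean (indep μ) fun s =>
    multilinear (fun p => if own p ∈ B then 0 else x p) fun R => f (R ∪ B.biUnion s)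

theorem hybridUtility_empty : hybridUtility own f x μ ∅ = multilinear x f := by
  simp [hybridUtility, mean_const]

theorem hybridUtility_univ :
    hybridUtility own f x μ Finset.univ = mean (indep μ) fun s => f (Finset.univ.biUnion s) := by
  simp only [hybridUtility, Finset.mem_univ, if_true]
  congr 1
  ext s
  exact (multilinear_zero _).trans (by rw [Finset.empty_union])

theorem hybridUtility_le_insert (hown : IsOwner Pol own) (hsub : IsSubmodular f)
    (hx : x ∈ Set.Icc 0 1) (hsum : ∀ i, ∑ p ∈ Pol i, x p = 1)
    (hμ : ∀ i g, mean (μ i) g = ∑ p ∈ Pol i, x p * g {p}) {B : Finset A} {j : A} (hj : j ∉ B) :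
    hybridUtility own f x μ B ≤ hybridUtility own f x μ (insert j B) := by
  set z : P → ℝ := fun p => if own p ∈ B then 0 else x p
  have hz : z ∈ Set.Icc 0 1 :=
    ⟨fun p => by dsimp only [z]; split_ifs; exacts [le_rfl, hx.1 p],
      fun p => by dsimp only [z]; split_ifs; exacts [zero_le_one, hx.2 p]⟩
  have z_eq : ∀ p ∈ Pol j, z p = x p := fun p hp => if_neg ((hown j p).1 hp ▸ hj)
  have piecewise_eq : (Pol j).piecewise (0 : P → ℝ) z =
      fun p => if own p ∈ insert j B then 0 else x p := by
    ext p
    simp only [Finset.piecewise, hown j p, Finset.mem_insert, z]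
    split_ifs <;> simp_all
  refine (mean_mono _ fun s => ?_).trans_eq (mean_indep_update μ j _)
  have biUnion_update (a : Finset P) :
      (insert j B).biUnion (Function.update s j a) = a ∪ B.biUnion s := by
    rw [Finset.biUnion_insert, Function.update_self]
    congr 1
    exact Finset.biUnion_congr rfl fun i hi =>
      Function.update_of_ne (ne_of_mem_of_not_mem hi hj) _ _
  refine ((hsub.union_right (B.biUnion s)).multilinear_le_sum_mul_multilinear_union_singleton hz
    (by rw [Finset.sum_congr rfl z_eq, hsum j])).trans_eq ?_
  rw [hμ, piecewise_eq]
  refine Finset.sum_congr rfl fun p hp => ?_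
  simp only [z_eq p hp, biUnion_update, Finset.union_assoc]

theorem multilinear_le_mean_indep (hown : IsOwner Pol own) (hsub : IsSubmodular f)
    (hx : x ∈ Set.Icc 0 1) (hsum : ∀ i, ∑ p ∈ Pol i, x p = 1)
    (hμ : ∀ i g, mean (μ i) g = ∑ p ∈ Pol i, x p * g {p}) :
    multilinear x f ≤ mean (indep μ) fun s => f (Finset.univ.biUnion s) := by
  rw [← hybridUtility_univ (own := own) (x := x)]
  induction (Finset.univ : Finset A) using Finset.induction_on with
  | empty => exact hybridUtility_empty.ge
  | insert j B hj ih => exact ih.trans (hybridUtility_le_insert hown hsub hx hsum hμ hj)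

end Rounding

section Output

variable {A P : Type*} [DecidableEq P] {Pol : A → Finset P} {F : A → Info P}

theorem samplePolicy_eq_map {i : A}
    (h : ∑ p : {p // p ∈ Pol i}, ENNReal.ofReal ((F i).prob p) = 1) :
    samplePolicy Pol F i = (PMF.ofFintype (fun p : {p // p ∈ Pol i} =>
      ENNReal.ofReal ((F i).prob p)) h).map fun p : {p // p ∈ Pol i} => ({(p : P)} : Finset P) := by
  rw [samplePolicy, dif_pos h]
  exact PMF.map_comp Subtype.val _ fun p : P => ({p} : Finset P)

theorem sum_ofReal_prob_eq_one {i : A} (h0 : 0 ≤ (F i).prob) (h1 : ∑ p ∈ Pol i, (F i).prob p = 1) :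
    ∑ p : {p // p ∈ Pol i}, ENNReal.ofReal ((F i).prob p) = 1 := by
  rw [Finset.sum_coe_sort (Pol i) fun p => ENNReal.ofReal ((F i).prob p),
    ← ENNReal.ofReal_sum_of_nonneg fun p _ => h0 p, h1, ENNReal.ofReal_one]

theorem mean_samplePolicy [Fintype P] {i : A} (h0 : 0 ≤ (F i).prob)
    (h1 : ∑ p ∈ Pol i, (F i).prob p = 1) (g : Finset P → ℝ) :
    mean (samplePolicy Pol F i) g = ∑ p ∈ Pol i, (F i).prob p * g {p} := by
  rw [samplePolicy_eq_map (sum_ofReal_prob_eq_one h0 h1), mean_map, mean,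
    ← Finset.sum_coe_sort (Pol i) fun p => (F i).prob p * g {p}]
  refine Finset.sum_congr rfl fun p _ => ?_
  rw [PMF.ofFintype_apply, ENNReal.toReal_ofReal (h0 p)]
  rfl

theorem exists_eq_singleton_of_mem_support_samplePolicy {i : A} (h0 : 0 ≤ (F i).prob)
    (h1 : ∑ p ∈ Pol i, (F i).prob p = 1) {R : Finset P}
    (hR : R ∈ (samplePolicy Pol F i).support) : ∃ p ∈ Pol i, R = {p} := by
  rw [samplePolicy_eq_map (sum_ofReal_prob_eq_one h0 h1), PMF.mem_support_map_iff] at hR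
  obtain ⟨p, -, hp⟩ := hR
  exact ⟨p, p.2, hp.symm⟩

variable [Fintype A] [DecidableEq A] [Fintype P]

theorem admissible_of_mem_support_output {own : P → A} (hown : IsOwner Pol own)
    (h0 : ∀ i, 0 ≤ (F i).prob) (h1 : ∀ i, ∑ p ∈ Pol i, (F i).prob p = 1) {R : Finset P}
    (hR : R ∈ (output Pol F).support) : Admissible Pol R := by
  obtain ⟨s, hs, rfl⟩ := (PMF.mem_support_map_iff _ _ _).1 hR
  have mem_support (i : A) : s i ∈ (samplePolicy Pol F i).support :=
    Finset.prod_ne_zero_iff.1 hs i (Finset.mem_univ i)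
  choose q hq s_eq using fun i : A =>
    exists_eq_singleton_of_mem_support_samplePolicy (h0 i) (h1 i) (mem_support i)
  intro i
  rw [← Finset.card_singleton (q i)]
  refine Finset.card_le_card fun p hp => ?_
  simp only [Finset.mem_inter, Finset.mem_biUnion, Finset.mem_univ, true_and, s_eq,
    Finset.mem_singleton] at hp ⊢
  obtain ⟨⟨j, rfl⟩, hpi⟩ := hp
  rw [← (hown i _).1 hpi, (hown j _).1 (hq j)]

theorem multilinear_ownProb_le_expectedUtility {own : P → A} (hown : IsOwner Pol own)
    {f : Finset P → ℝ} (hsub : IsSubmodular f) (h0 : ∀ i, 0 ≤ (F i).prob)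
    (h1 : ∀ i, ∑ p ∈ Pol i, (F i).prob p = 1) (hle : ownProb own F ≤ 1) :
    multilinear (ownProb own F) f ≤ expectedUtility Pol f F := by
  have ownProb_eq {i : A} {p : P} (hp : p ∈ Pol i) : ownProb own F p = (F i).prob p := by
    rw [ownProb, (hown i p).1 hp]
  calc multilinear (ownProb own F) f
      ≤ mean (indep (samplePolicy Pol F)) fun s => f (Finset.univ.biUnion s) :=
        multilinear_le_mean_indep hown hsub
          ⟨fun p => h0 (own p) p, hle⟩
          (fun i => (Finset.sum_congr rfl fun p hp => ownProb_eq hp).trans (h1 i))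
          fun i g => by
            rw [mean_samplePolicy (h0 i) (h1 i)]
            exact Finset.sum_congr rfl fun p hp => by rw [ownProb_eq hp]
    _ = mean (output Pol F) f := (mean_map _ _ _).symm

end Output

section Guarantee

theorem one_sub_inv_exp_one_nonneg : 0 ≤ 1 - 1 / Real.exp 1 := by
  rw [sub_nonneg, one_div]
  exact inv_le_one_of_one_le₀ (Real.one_le_exp zero_le_one)

theorem one_sub_inv_exp_one_mul_le_of_gap_le {T : ℕ} (hT : 1 ≤ T) {B U : ℝ} (hU : 0 ≤ U)
    (gap_le : B - U ≤ (1 - 1 / (T : ℝ)) ^ T * B) : (1 - 1 / Real.exp 1) * B ≤ U := by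
  have pow_le : (1 - 1 / (T : ℝ)) ^ T ≤ 1 / Real.exp 1 := by
    rw [one_div (Real.exp 1), ← Real.exp_neg]
    exact Real.one_sub_div_pow_le_exp_neg (by exact_mod_cast hT)
  rcases le_total 0 B with hB | hB
  · linarith [mul_le_mul_of_nonneg_right pow_le hB]
  · exact (mul_nonpos_of_nonneg_of_nonpos one_sub_inv_exp_one_nonneg hB).trans hU

variable {A P : Type*} [DecidableEq P] {G : SimpleGraph A} {Pol : A → Finset P} {own : P → A}
  {f : Finset P → ℝ} {S : Finset P} {T : ℕ} {F : A → Info P}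

theorem Invariant.sum_prob_eq_one (h : Invariant G Pol own T T F) (hown : IsOwner Pol own)
    (hT : 1 ≤ T) (i : A) : ∑ p ∈ Pol i, (F i).prob p = 1 := by
  rw [h.sum_prob hown i, mul_one_div_cancel (by positivity)]

theorem Invariant.one_sub_inv_exp_one_mul_le [Fintype A] [DecidableEq A] [Fintype P]
    (h : Invariant G Pol own T T F) (hown : IsOwner Pol own) (hmono : Monotone f)
    (hsub : IsSubmodular f) (hT : 1 ≤ T) {V : ℝ}
    (gap_le : V - multilinear (ownProb own F) f ≤ (1 - 1 / (T : ℝ)) ^ T * (V - f ∅)) :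
    (1 - 1 / Real.exp 1) * (V - f ∅) ≤ expectedUtility Pol f F - f ∅ := by
  have hy := h.ownProb_le_one hown le_rfl
  have empty_le : f ∅ ≤ multilinear (ownProb own F) f :=
    le_multilinear_of_forall_le ⟨h.ownProb_nonneg, hy⟩ fun R => hmono (Finset.empty_subset R)
  have rounding_le := multilinear_ownProb_le_expectedUtility hown hsub h.prob_nonneg
    (h.sum_prob_eq_one hown hT) hy
  exact one_sub_inv_exp_one_mul_le_of_gap_le hT (by linarith) (by linarith)

theorem IsOptimizer.singleton_le (h : IsOptimizer Pol f S) (p : P) : f {p} ≤ f S :=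
  h.2 _ fun _ => (Finset.card_le_card Finset.inter_subset_left).trans_eq (Finset.card_singleton p)

theorem IsOptimizer.le_of_one_sub_inv_exp_one_mul_le [Fintype A]
    (h : IsOptimizer Pol f S) (hf0 : f ∅ = 0) {U : ℝ}
    (hU : (1 - 1 / Real.exp 1) * (f S - stepLoss G T (f S) - f ∅) ≤ U - f ∅) :
    (1 - 1 / Real.exp 1) *
        (1 - (2 * (Fintype.card A : ℝ) ^ 2 * (G.diam : ℝ) + (Fintype.card A : ℝ) ^ 2 / 2
          + (Fintype.card A : ℝ)) * (1 / (T : ℝ))) * f S ≤ U := by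
  have optimum_nonneg : 0 ≤ f S := hf0.ge.trans (h.2 ∅ fun i => by simp)
  have lag_nonneg : 0 ≤ (Fintype.card A : ℝ) ^ 2 * G.diam * (1 / (T : ℝ)) * f S := by positivity
  rw [hf0, sub_zero, sub_zero, stepLoss] at hU
  refine le_trans ?_ hU
  rw [mul_assoc]
  exact mul_le_mul_of_nonneg_left (by linarith) one_sub_inv_exp_one_nonneg

end Guarantee

end DistGreedy

open DistGreedy in
theorem mainTheorem1_general {A P L : Type*} [Fintype A] [DecidableEq A] [Fintype P]
    [DecidableEq P] [Fintype L] [DecidableEq L]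
    (G : SimpleGraph A) (hG : G.Connected) (Pol : A → Finset P)
    (hdisj : ∀ i j, i ≠ j → Disjoint (Pol i) (Pol j)) (hcover : ∀ p, ∃ i, p ∈ Pol i)
    (f : Finset P → ℝ) (hmono : Monotone f) (hsub : IsSubmodular f)
    (S : Finset P) (hS : Admissible Pol S) (M : ℝ) (hM : ∀ p, f {p} - f ∅ ≤ M)
    (T : ℕ) (hT : 1 ≤ T) (K : A → ℕ) (β : P → L)
    (hK : ∀ i l, 2 * (((Pol i).filter fun p => β p = l).card : ℝ)
      * Real.exp (-(K i : ℝ) / (8 * (T : ℝ) ^ 2)) ≤ 1)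
    (sel : Selection Pol) (hsel : sel.IsArgmax) :
    (∀ t ≤ T, ∀ F ∈ (run G Pol f T K β sel t).support, ∀ i p,
      0 ≤ (F i).prob p ∧ (F i).prob p ≤ 1) ∧
    (∀ F ∈ (run G Pol f T K β sel T).support,
      (∀ i, ∑ p ∈ Pol i, (F i).prob p = 1) ∧
      ∀ R ∈ (output Pol F).support, Admissible Pol R) ∧
    ENNReal.ofReal (accuracyProb Pol T K ^ T) ≤
      (run G Pol f T K β sel T).toOuterMeasure
        {F | (1 - 1 / Real.exp 1) * (f S - stepLoss G T M - f ∅)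
          ≤ expectedUtility Pol f F - f ∅} := by
  obtain ⟨own, hown⟩ := exists_isOwner hdisj hcover
  have invariant {t : ℕ} {F : A → Info P} (hF : F ∈ (run G Pol f T K β sel t).support) :=
    Invariant.of_mem_support hown hF
  refine ⟨fun t ht F hF i p => ?_, fun F hF => ⟨?_, fun R hR => ?_⟩, ?_⟩
  · have prob_mem := (invariant hF).prob_mem_Icc hown ht i
    exact ⟨prob_mem.1 p, prob_mem.2 p⟩
  · exact (invariant hF).sum_prob_eq_one hown hT
  · exact admissible_of_mem_support_output hown (invariant hF).prob_nonneg
      ((invariant hF).sum_prob_eq_one hown hT) hR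
  · rw [ENNReal.ofReal_pow (accuracyProb_nonneg hK)]
    refine (accuracyProb_pow_le_run hown hG hmono hsub
      (fun p R => (hsub.marginal_le p R).trans (hM p)) hsel hK hS le_rfl).trans
      (PMF.toOuterMeasure_mono _ fun F ⟨gap_le, hF⟩ => ?_)
    exact (invariant hF).one_sub_inv_exp_one_mul_le hown hmono hsub hT gap_le

theorem mainTheorem1 {A P L : Type*} [Fintype A] [DecidableEq A] [Fintype P] [DecidableEq P]
    [Fintype L] [DecidableEq L]
    (G : SimpleGraph A) (hG : G.Connected)
    (Pol : A → Finset P) (hne : ∀ i, (Pol i).Nonempty)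
    (hdisj : ∀ i j, i ≠ j → Disjoint (Pol i) (Pol j)) (hcover : ∀ p, ∃ i, p ∈ Pol i)
    (f : Finset P → ℝ) (hf0 : f ∅ = 0) (hmono : Monotone f) (hsub : DistGreedy.IsSubmodular f)
    (Sopt : Finset P) (hopt : DistGreedy.IsOptimizer Pol f Sopt)
    (T : ℕ) (hT : 1 ≤ T) (K : A → ℕ)
    (β : P → L)
    (hK : ∀ i l, 2 * (((Pol i).filter fun p => β p = l).card : ℝ)
      * Real.exp (-(K i : ℝ) / (8 * (T : ℝ) ^ 2)) ≤ 1)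
    (sel : DistGreedy.Selection Pol) (hsel : sel.IsArgmax) :
    (∀ t ≤ T, ∀ F ∈ (DistGreedy.run G Pol f T K β sel t).support, ∀ i p,
      0 ≤ (F i).prob p ∧ (F i).prob p ≤ 1) ∧
    (∀ F ∈ (DistGreedy.run G Pol f T K β sel T).support,
      (∀ i, ∑ p ∈ Pol i, (F i).prob p = 1) ∧
      ∀ S ∈ (DistGreedy.output Pol F).support, DistGreedy.Admissible Pol S) ∧
    ENNReal.ofReal
        ((∏ i, (1 - 2 * Real.exp (-(K i : ℝ) / (8 * (T : ℝ) ^ 2))) ^ (Pol i).card) ^ T) ≤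
      (DistGreedy.run G Pol f T K β sel T).toOuterMeasure
        {F | (1 - 1 / Real.exp 1) *
            (1 - (2 * (Fintype.card A : ℝ) ^ 2 * (G.diam : ℝ) + (Fintype.card A : ℝ) ^ 2 / 2
              + (Fintype.card A : ℝ)) * (1 / (T : ℝ))) * f Sopt
          ≤ DistGreedy.expectedUtility Pol f F} := by
  obtain ⟨prob_mem, output_mem, guarantee⟩ := mainTheorem1_general G hG Pol hdisj hcover f hmono
    hsub Sopt hopt.1 (f Sopt) (fun p => by simpa [hf0] using hopt.singleton_le p) T hT K β hK sel
    hsel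
  exact ⟨prob_mem, output_mem, guarantee.trans (MeasureTheory.measure_mono fun F hF =>
    hopt.le_of_one_sub_inv_exp_one_mul_le hf0 hF)⟩
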